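/- Let $D$ be one of the domains $\mathbb Z,\mathbb Q,\mathbb R$. Constraints over a set of variables are generated by $e ::= v \mid k \mid e+e \mid e-e$ and $c ::= e=e \mid e\neq e \mid e<e \mid e\le e \mid c\wedge c$, where $k$ is a constant (an integer if $D=\mathbb Z$, a rational number if $D=\mathbb Q$ or $D=\mathbb R$); formulas are the first-order formulas with such constraints as atoms, interpreted in $D$, and $\equiv$ is logical equivalence over $D$. A DDSA $\mathcal B=\langle B,b_0,\mathcal A,T,F,V,\alpha_0,\mathit{guard}\rangle$ consists of a finite set $B$ of states with initial state $b_0$ and final states $F\subseteq B$, a finite set $\mathcal A$ of actions, a transition function $T\colon B\times\mathcal A\to B$ (write $b\xrightarrow{a}b'$ for $T(b,a)=b'$), a finite set $V$ of variables with an initial assignment $\alpha_0$ of constants to them, and a guard for each action, which is a constraint over two disjoint copies $V^r$ (read) and $V^w$ (write) of $V$. Let $\mathcal C$ be a finite set of constraints over $V$. For an action $a$ let $\Delta_a=\mathit{guard}(a)\wedge\bigwedge v^w=v^r$, where the conjunction is over all $v\in V$ such that $v^w$ does not occur in $\mathit{guard}(a)$, and for a formula $\varphi$ with free variables $V$ let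 $\mathit{update}(\varphi,a)=\exists \vec U.\,\varphi(\vec U)\wedge\Delta_a(\vec U,\vec V)$. For a symbolic run $\sigma\colon b_0\xrightarrow{a_1}b_1\cdots\xrightarrow{a_n}b_n$ and sets $C_0,\dots,C_n\subseteq\mathcal C$, the history constraint is $h(\sigma,\langle C_0\rangle)=\bigwedge_{v\in V}(v=\alpha_0(v))\wedge\bigwedge C_0$ if $n=0$, and otherwise $h(\sigma,\langle C_0,\dots,C_n\rangle)=\mathit{update}(h(\sigma|_{n-1},\langle C_0,\dots,C_{n-1}\rangle),a_n)\wedge\bigwedge C_n$, where $\sigma|_{n-1}$ is the prefix of $\sigma$ with $n-1$ steps. A history set for $(\mathcal B,\mathcal C)$ is a set $\Phi$ of pairs $(b,\varphi)$ of a state and a formula with free variables $V$ such that every history constraint of a symbolic run with last state $b$ is equivalent to some $\varphi$ with $(b,\varphi)\in\Phi$, and every $(b,\varphi)\in\Phi$ arises in this way. $(\mathcal B,\mathcal C)$ has finite summary if there are a history set $\Phi$ and an equivalence relation $\sim$ on the formulas that occur in $\Phi$, with finitely many equivalence classes, such that (1) $\sim$ contains $\equiv$ and is decidable, and (2) for all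 $(b,\varphi),(b,\psi)\in\Phi$ with $\varphi\sim\psi$: (a) $\varphi$ is satisfiable if and only if $\psi$ is, and (b) for all $b\xrightarrow{a}b'$ and $C\subseteq\mathcal C$, representatives $\varphi'\equiv\mathit{update}(\varphi,a)\wedge\bigwedge C$ and $\psi'\equiv\mathit{update}(\psi,a)\wedge\bigwedge C$ with $(b',\varphi'),(b',\psi')\in\Phi$ satisfy $\varphi'\sim\psi'$. **Lemma.** For each of the domains $D=\mathbb Z$, $D=\mathbb Q$ and $D=\mathbb R$, it is undecidable whether a given pair $(\mathcal B,\mathcal C)$ of a DDSA $\mathcal B$ and a finite constraint set $\mathcal C$ has finite summary: there is no algorithm that, given (a code of) $(\mathcal B,\mathcal C)$, decides this. -/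

import Mathlib

/-! ### Gödel numberings and algorithmic decidability -/

/-- An injective numbering of the finite objects of a type. -/
class Coded (α : Type) where
  code : α → ℕ
  code_injective : Function.Injective code

/-- A property of coded objects is decidable if some computable (general recursive) function
on natural numbers gives the right answer on the code of every object. -/
def AlgDecidable {α : Type} [Coded α] (P : α → Prop) : Prop :=
  ∃ f : ℕ → Bool, Computable f ∧ ∀ x : α, f (Coded.code x) = true ↔ P x

instance instCodedFin (n : ℕ) : Coded (Fin n) where
  code i := i.val
  code_injective := Fin.val_injective

instance instCodedBool : Coded Bool where
  code b := b.toNat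
  code_injective := by decide

instance instCodedInt : Coded ℤ where
  code z := if 0 ≤ z then 2 * z.natAbs else 2 * z.natAbs + 1
  code_injective := by
    intro a b h
    dsimp only at h
    split_ifs at h <;> omega

instance instCodedRat : Coded ℚ where
  code q := Nat.pair (Coded.code q.num) q.den
  code_injective := by
    intro p q h
    obtain ⟨h1, h2⟩ := Nat.pair_eq_pair.mp h
    exact Rat.ext (Coded.code_injective h1) h2

instance instCodedSum {α β : Type} [Coded α] [Coded β] : Coded (α ⊕ β) where
  code := Sum.elim (fun a => 2 * Coded.code a) (fun b => 2 * Coded.code b + 1)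
  code_injective := by
    rintro (a | a) (b | b) h <;> simp only [Sum.elim_inl, Sum.elim_inr] at h
    · exact congrArg Sum.inl (Coded.code_injective (by omega))
    · omega
    · omega
    · exact congrArg Sum.inr (Coded.code_injective (by omega))

instance instCodedProd {α β : Type} [Coded α] [Coded β] : Coded (α × β) where
  code p := Nat.pair (Coded.code p.1) (Coded.code p.2)
  code_injective := by
    intro p q h
    obtain ⟨h1, h2⟩ := Nat.pair_eq_pair.mp h
    exact Prod.ext (Coded.code_injective h1) (Coded.code_injective h2)

instance instCodedSubtype {α : Type} [Coded α] (p : α → Prop) : Coded {x : α // p x} where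
  code x := Coded.code x.1
  code_injective := Coded.code_injective.comp Subtype.val_injective

instance instCodedList {α : Type} [Coded α] : Coded (List α) where
  code l := Encodable.encode (l.map Coded.code)
  code_injective :=
    Encodable.encode_injective.comp (List.map_injective_iff.mpr Coded.code_injective)

/-- A function on `Fin n` is coded as the list of its values. -/
instance instCodedFinFun {n : ℕ} {α : Type} [Coded α] : Coded (Fin n → α) where
  code f := Coded.code (List.ofFn f)
  code_injective := Coded.code_injective.comp List.ofFn_injective

namespace DDSAs

/-! ### Linear arithmetic: expressions, constraints, formulas

`K` is the type of constants that may be written down, `D` the domain over which variables range;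
a constant `k : K` denotes `algebraMap K D k`. -/

/-- `e ::= v | k | e + e | e - e`, with variables from `X`. -/
inductive Expr (K X : Type) : Type
  | var (x : X)
  | const (k : K)
  | add (e₁ e₂ : Expr K X)
  | sub (e₁ e₂ : Expr K X)

/-- `c ::= e = e | e ≠ e | e < e | e ≤ e | c ∧ c`. -/
inductive Constraint (K X : Type) : Type
  | eq (e₁ e₂ : Expr K X)
  | ne (e₁ e₂ : Expr K X)
  | lt (e₁ e₂ : Expr K X)
  | le (e₁ e₂ : Expr K X)
  | and (c₁ c₂ : Constraint K X)

/-- First-order formulas of linear arithmetic with free variables indexed by `Fin m`.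
`ex k φ` quantifies existentially over the last `k` variables of `φ`. -/
inductive Formula (K : Type) : ℕ → Type
  | tru {m : ℕ} : Formula K m
  | atom {m : ℕ} (c : Constraint K (Fin m)) : Formula K m
  | neg {m : ℕ} (φ : Formula K m) : Formula K m
  | and {m : ℕ} (φ ψ : Formula K m) : Formula K m
  | or {m : ℕ} (φ ψ : Formula K m) : Formula K m
  | ex {m : ℕ} (k : ℕ) (φ : Formula K (m + k)) : Formula K m

namespace Expr

variable {K X Y : Type}

/-- Renaming of variables. -/
def rename (f : X → Y) : Expr K X → Expr K Y
  | var x => var (f x)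
  | const k => const k
  | add e₁ e₂ => add (e₁.rename f) (e₂.rename f)
  | sub e₁ e₂ => sub (e₁.rename f) (e₂.rename f)

/-- The variable `x` occurs in the expression. -/
def Occurs (x : X) : Expr K X → Prop
  | var y => x = y
  | const _ => False
  | add e₁ e₂ => e₁.Occurs x ∨ e₂.Occurs x
  | sub e₁ e₂ => e₁.Occurs x ∨ e₂.Occurs x

/-- The value of an expression under an assignment. -/
def eval {D : Type} [CommRing K] [CommRing D] [Algebra K D] (α : X → D) : Expr K X → D
  | var x => α x
  | const k => algebraMap K D k
  | add e₁ e₂ => e₁.eval α + e₂.eval α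
  | sub e₁ e₂ => e₁.eval α - e₂.eval α

/-- Gödel number of an expression. -/
def godel [Coded K] [Coded X] : Expr K X → ℕ
  | var x => Nat.pair 0 (Coded.code x)
  | const k => Nat.pair 1 (Coded.code k)
  | add e₁ e₂ => Nat.pair 2 (Nat.pair e₁.godel e₂.godel)
  | sub e₁ e₂ => Nat.pair 3 (Nat.pair e₁.godel e₂.godel)

theorem godel_injective [Coded K] [Coded X] :
    Function.Injective (godel : Expr K X → ℕ) := by
  intro e
  induction e with
  | var x =>
    intro e' h
    cases e' <;> simp [godel, Nat.pair_eq_pair] at h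
    rw [Coded.code_injective h]
  | const k =>
    intro e' h
    cases e' <;> simp [godel, Nat.pair_eq_pair] at h
    rw [Coded.code_injective h]
  | add e₁ e₂ ih₁ ih₂ =>
    intro e' h
    cases e' <;> simp [godel, Nat.pair_eq_pair] at h
    rw [ih₁ h.1, ih₂ h.2]
  | sub e₁ e₂ ih₁ ih₂ =>
    intro e' h
    cases e' <;> simp [godel, Nat.pair_eq_pair] at h
    rw [ih₁ h.1, ih₂ h.2]

instance instCoded [Coded K] [Coded X] : Coded (Expr K X) := ⟨godel, godel_injective⟩

end Expr

namespace Constraint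

variable {K X Y : Type}

/-- Renaming of variables. -/
def rename (f : X → Y) : Constraint K X → Constraint K Y
  | eq e₁ e₂ => eq (e₁.rename f) (e₂.rename f)
  | ne e₁ e₂ => ne (e₁.rename f) (e₂.rename f)
  | lt e₁ e₂ => lt (e₁.rename f) (e₂.rename f)
  | le e₁ e₂ => le (e₁.rename f) (e₂.rename f)
  | and c₁ c₂ => and (c₁.rename f) (c₂.rename f)

/-- The variable `x` occurs in the constraint. -/
def Occurs (x : X) : Constraint K X → Prop
  | eq e₁ e₂ => e₁.Occurs x ∨ e₂.Occurs x
  | ne e₁ e₂ => e₁.Occurs x ∨ e₂.Occurs x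
  | lt e₁ e₂ => e₁.Occurs x ∨ e₂.Occurs x
  | le e₁ e₂ => e₁.Occurs x ∨ e₂.Occurs x
  | and c₁ c₂ => c₁.Occurs x ∨ c₂.Occurs x

/-- Satisfaction of a constraint by an assignment. -/
def Sat {D : Type} [CommRing K] [CommRing D] [LinearOrder D] [Algebra K D] (α : X → D) :
    Constraint K X → Prop
  | eq e₁ e₂ => e₁.eval α = e₂.eval α
  | ne e₁ e₂ => e₁.eval α ≠ e₂.eval α
  | lt e₁ e₂ => e₁.eval α < e₂.eval α
  | le e₁ e₂ => e₁.eval α ≤ e₂.eval α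
  | and c₁ c₂ => c₁.Sat α ∧ c₂.Sat α

/-- Gödel number of a constraint. -/
def godel [Coded K] [Coded X] : Constraint K X → ℕ
  | eq e₁ e₂ => Nat.pair 0 (Nat.pair (Coded.code e₁) (Coded.code e₂))
  | ne e₁ e₂ => Nat.pair 1 (Nat.pair (Coded.code e₁) (Coded.code e₂))
  | lt e₁ e₂ => Nat.pair 2 (Nat.pair (Coded.code e₁) (Coded.code e₂))
  | le e₁ e₂ => Nat.pair 3 (Nat.pair (Coded.code e₁) (Coded.code e₂))
  | and c₁ c₂ => Nat.pair 4 (Nat.pair c₁.godel c₂.godel)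

theorem godel_injective [Coded K] [Coded X] :
    Function.Injective (godel : Constraint K X → ℕ) := by
  intro c
  induction c with
  | and c₁ c₂ ih₁ ih₂ =>
    intro c' h
    cases c' <;> simp [godel, Nat.pair_eq_pair] at h
    rw [ih₁ h.1, ih₂ h.2]
  | _ e₁ e₂ =>
    intro c' h
    cases c' <;> simp [godel, Nat.pair_eq_pair] at h
    rw [Coded.code_injective h.1, Coded.code_injective h.2]

instance instCoded [Coded K] [Coded X] : Coded (Constraint K X) := ⟨godel, godel_injective⟩

end Constraint

namespace Formula

variable {K : Type}

/-- Renaming of free variables (bound variables are kept apart, so nothing is captured). -/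
def rename : {m m' : ℕ} → (Fin m → Fin m') → Formula K m → Formula K m'
  | _, _, _, tru => tru
  | _, _, f, atom c => atom (c.rename f)
  | _, _, f, neg φ => neg (φ.rename f)
  | _, _, f, and φ ψ => and (φ.rename f) (ψ.rename f)
  | _, _, f, or φ ψ => or (φ.rename f) (ψ.rename f)
  | _, m', f, ex k φ =>
    ex k (φ.rename (Fin.addCases (fun i => Fin.castAdd k (f i)) (fun j => Fin.natAdd m' j)))

/-- Satisfaction of a formula by an assignment of its free variables. -/
def Sat {D : Type} [CommRing K] [CommRing D] [LinearOrder D] [Algebra K D] :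
    {m : ℕ} → (Fin m → D) → Formula K m → Prop
  | _, _, tru => True
  | _, α, atom c => c.Sat α
  | _, α, neg φ => ¬ φ.Sat α
  | _, α, and φ ψ => φ.Sat α ∧ ψ.Sat α
  | _, α, or φ ψ => φ.Sat α ∨ ψ.Sat α
  | _, α, ex k φ => ∃ u : Fin k → D, φ.Sat (Fin.append α u)

/-- The conjunction of finitely many constraints. -/
def conj {m : ℕ} : List (Constraint K (Fin m)) → Formula K m
  | [] => tru
  | c :: l => and (atom c) (conj l)

/-- Gödel number of a formula. -/
def godel [Coded K] : {m : ℕ} → Formula K m → ℕ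
  | _, tru => Nat.pair 0 0
  | _, atom c => Nat.pair 1 (Coded.code c)
  | _, neg φ => Nat.pair 2 φ.godel
  | _, and φ ψ => Nat.pair 3 (Nat.pair φ.godel ψ.godel)
  | _, or φ ψ => Nat.pair 4 (Nat.pair φ.godel ψ.godel)
  | _, ex k φ => Nat.pair 5 (Nat.pair k φ.godel)

theorem godel_injective [Coded K] {m : ℕ} :
    Function.Injective (godel : Formula K m → ℕ) := by
  intro φ
  induction φ with
  | tru =>
    intro φ' h
    cases φ' <;> simp [godel, Nat.pair_eq_pair] at h
    rfl
  | atom c =>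
    intro φ' h
    cases φ' <;> simp [godel, Nat.pair_eq_pair] at h
    rw [Coded.code_injective h]
  | neg φ ih =>
    intro φ' h
    cases φ' <;> simp [godel, Nat.pair_eq_pair] at h
    rw [ih h]
  | and φ ψ ih₁ ih₂ =>
    intro φ' h
    cases φ' <;> simp [godel, Nat.pair_eq_pair] at h
    rw [ih₁ h.1, ih₂ h.2]
  | or φ ψ ih₁ ih₂ =>
    intro φ' h
    cases φ' <;> simp [godel, Nat.pair_eq_pair] at h
    rw [ih₁ h.1, ih₂ h.2]
  | ex k φ ih =>
    intro φ' h
    cases φ' <;> simp [godel, Nat.pair_eq_pair] at h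
    obtain ⟨rfl, h⟩ := h
    rw [ih h]

instance instCoded [Coded K] {m : ℕ} : Coded (Formula K m) := ⟨godel, godel_injective⟩

section Semantics

variable (D : Type) [CommRing K] [CommRing D] [LinearOrder D] [Algebra K D] {m : ℕ}

/-- Logical equivalence over the domain `D`. -/
def Equiv (φ ψ : Formula K m) : Prop := ∀ α : Fin m → D, φ.Sat α ↔ ψ.Sat α

/-- Satisfiability over the domain `D`. -/
def Satisfiable (φ : Formula K m) : Prop := ∃ α : Fin m → D, φ.Sat α

end Semantics

end Formula

/-! ### Data-aware dynamic systems with arithmetic -/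

/-- A DDSA `⟨B, b₀, A, T, F, V, α₀, guard⟩` with `B`, `A` and `V` of the form `Fin _`.
Guards range over `V^r ⊕ V^w`: `Sum.inl v` is the read and `Sum.inr v` the write copy of `v`. -/
structure DDSA (K : Type) where
  numStates : ℕ
  numActions : ℕ
  numVars : ℕ
  init : Fin numStates
  trans : Fin numStates → Fin numActions → Fin numStates
  final : Fin numStates → Bool
  initVal : Fin numVars → K
  guard : Fin numActions → Constraint K (Fin numVars ⊕ Fin numVars)

/-- A DDSA together with a finite set of constraints over its variables, given as a list. -/
structure Input (K : Type) where
  sys : DDSA K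
  constraints : List (Constraint K (Fin sys.numVars))

namespace DDSA

variable {K : Type}

instance instCoded [Coded K] : Coded (DDSA K) where
  code S := Nat.pair S.numStates (Nat.pair S.numActions (Nat.pair S.numVars
    (Nat.pair (Coded.code S.init) (Nat.pair (Coded.code S.trans) (Nat.pair (Coded.code S.final)
      (Nat.pair (Coded.code S.initVal) (Coded.code S.guard)))))))
  code_injective := by
    rintro ⟨b, a, n, i, t, f, v, g⟩ ⟨b', a', n', i', t', f', v', g'⟩ h
    simp only [Nat.pair_eq_pair] at h
    obtain ⟨rfl, rfl, rfl, hi, ht, hf, hv, hg⟩ := h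
    rw [Coded.code_injective hi, Coded.code_injective ht, Coded.code_injective hf,
      Coded.code_injective hv, Coded.code_injective hg]

/-- `write(a)`: the variables whose write copy occurs in the guard of `a`. -/
def Writes (S : DDSA K) (a : Fin S.numActions) (v : Fin S.numVars) : Prop :=
  (S.guard a).Occurs (Sum.inr v)

open Classical in
/-- The conjuncts of the transition formula `Δ_a`: the guard of `a`, and `v^w = v^r` for every
variable `v` not written by `a`. -/
noncomputable def transition (S : DDSA K) (a : Fin S.numActions) :
    List (Constraint K (Fin S.numVars ⊕ Fin S.numVars)) :=
  S.guard a :: ((List.finRange S.numVars).filter (fun v => ¬ S.Writes a v)).map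
    (fun v => Constraint.eq (Expr.var (Sum.inr v)) (Expr.var (Sum.inl v)))

/-- `update(φ, a) = ∃ U. φ(U) ∧ Δ_a(U, V)`. Among the variables `Fin (n + n)` under the quantifier
the first `n` are `V` and the last `n` are `U`. -/
noncomputable def update (S : DDSA K) (φ : Formula K S.numVars) (a : Fin S.numActions) :
    Formula K S.numVars :=
  Formula.ex S.numVars (Formula.and (φ.rename (Fin.natAdd S.numVars))
    (Formula.conj ((S.transition a).map (Constraint.rename
      (Sum.elim (Fin.natAdd S.numVars) (Fin.castAdd S.numVars))))))

/-- The initial constraints `{v = α₀(v) | v ∈ V}`. -/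
def initConstraints (S : DDSA K) : List (Constraint K (Fin S.numVars)) :=
  (List.finRange S.numVars).map
    (fun v => Constraint.eq (Expr.var v) (Expr.const (S.initVal v)))

/-- Symbolic runs `b₀ → b₁ → ⋯ → b` of `S`, indexed by their last state `b`. -/
inductive SymbolicRun (S : DDSA K) : Fin S.numStates → Type
  | start : SymbolicRun S S.init
  | step {b : Fin S.numStates} (σ : SymbolicRun S b) (a : Fin S.numActions) :
      SymbolicRun S (S.trans b a)

/-- The number of steps of a symbolic run. -/
def SymbolicRun.length {S : DDSA K} : {b : Fin S.numStates} → SymbolicRun S b → ℕ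
  | _, .start => 0
  | _, .step σ _ => σ.length + 1

/-- The history constraint `h(σ, ⟨C₀, …, Cₙ⟩)`, where `n` is the length of `σ`
(the entries of the sequence `C` beyond index `n` are not used). -/
noncomputable def hist {S : DDSA K} (C : ℕ → List (Constraint K (Fin S.numVars))) :
    {b : Fin S.numStates} → SymbolicRun S b → Formula K S.numVars
  | _, .start => Formula.conj (S.initConstraints ++ C 0)
  | _, .step σ a => Formula.and (S.update (hist C σ) a) (Formula.conj (C (σ.length + 1)))

section Summary

variable (D : Type) [CommRing K] [CommRing D] [LinearOrder D] [Algebra K D]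

/-- `Φ` is a history set for `S` and the constraint set `𝒞`: every history constraint of a symbolic
run that ends in `b` has an equivalent `φ` with `(b, φ) ∈ Φ`, and `Φ` has no other pairs. -/
def IsHistorySet (S : DDSA K) (𝒞 : List (Constraint K (Fin S.numVars)))
    (Φ : Set (Fin S.numStates × Formula K S.numVars)) : Prop :=
  (∀ (b : Fin S.numStates) (σ : SymbolicRun S b) (C : ℕ → List (Constraint K (Fin S.numVars))),
      (∀ i, C i ⊆ 𝒞) → ∃ φ, (b, φ) ∈ Φ ∧ (hist C σ).Equiv D φ) ∧
  (∀ b φ, (b, φ) ∈ Φ → ∃ (σ : SymbolicRun S b) (C : ℕ → List (Constraint K (Fin S.numVars))),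
      (∀ i, C i ⊆ 𝒞) ∧ (hist C σ).Equiv D φ)

/-- The formulas that occur in a set of pairs of a state and a formula. -/
abbrev FormulasOf {S : DDSA K} (Φ : Set (Fin S.numStates × Formula K S.numVars)) : Type :=
  {φ : Formula K S.numVars // ∃ b, (b, φ) ∈ Φ}

/-- `(Φ, r)` is a summary for `(S, 𝒞)`. In the last clause, `φ'` and `ψ'` are arbitrary
representatives in `Φ` of the updated formulas; since `Φ` is a history set such representatives
exist, and since `r` contains logical equivalence their choice does not matter. -/
structure IsSummary [Coded K] (S : DDSA K) (𝒞 : List (Constraint K (Fin S.numVars)))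
    (Φ : Set (Fin S.numStates × Formula K S.numVars)) (r : Setoid (FormulasOf Φ)) : Prop where
  historySet : S.IsHistorySet D 𝒞 Φ
  contains_equiv : ∀ φ ψ : FormulasOf Φ, φ.1.Equiv D ψ.1 → r φ ψ
  decidable : AlgDecidable (fun p : FormulasOf Φ × FormulasOf Φ => r p.1 p.2)
  equisatisfiable : ∀ (b : Fin S.numStates) (φ ψ : FormulasOf Φ), (b, φ.1) ∈ Φ → (b, ψ.1) ∈ Φ →
    r φ ψ → (φ.1.Satisfiable D ↔ ψ.1.Satisfiable D)
  update_congr : ∀ (b : Fin S.numStates) (φ ψ : FormulasOf Φ), (b, φ.1) ∈ Φ → (b, ψ.1) ∈ Φ →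
    r φ ψ → ∀ (a : Fin S.numActions) (C : List (Constraint K (Fin S.numVars))), C ⊆ 𝒞 →
    ∀ φ' ψ' : FormulasOf Φ, (S.trans b a, φ'.1) ∈ Φ → (S.trans b a, ψ'.1) ∈ Φ →
      φ'.1.Equiv D (Formula.and (S.update φ.1 a) (Formula.conj C)) →
      ψ'.1.Equiv D (Formula.and (S.update ψ.1 a) (Formula.conj C)) → r φ' ψ'

/-- `(S, 𝒞)` has finite summary over the domain `D`. -/
def HasFiniteSummary [Coded K] (S : DDSA K) (𝒞 : List (Constraint K (Fin S.numVars))) : Prop :=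
  ∃ (Φ : Set (Fin S.numStates × Formula K S.numVars)) (r : Setoid (FormulasOf Φ)),
    S.IsSummary D 𝒞 Φ r ∧ Finite (Quotient r)

end Summary

end DDSA

instance instCodedInput {K : Type} [Coded K] : Coded (Input K) where
  code I := Nat.pair (Coded.code I.sys) (Coded.code I.constraints)
  code_injective := by
    rintro ⟨S, l⟩ ⟨S', l'⟩ h
    simp only [Nat.pair_eq_pair] at h
    obtain ⟨hS, hl⟩ := h
    obtain rfl := Coded.code_injective hS
    rw [Coded.code_injective hl]

end DDSAs

namespace DDSAs

/-! The proof encodes computations as one-state DDSAs with `𝒞 = []`, and uses recursively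
inseparable sets. Take a partial recursive `f` such that no computable function separates the inputs
with value `0` from those with value `1` (`exists_inseparable`). A register program computes `f`
(`computable_of_partrec'`). After it, `thenDiverge` halts on the value `0` and on a nonzero value
counts register `2` up forever. Registers and program counter become DDSA variables, each control
step becomes a guarded assignment, and an extra action `drain` raises a fresh counter `m` while `m <
z`, where `z` is register `2`. Natural numbers embed into `ℤ`, `ℚ` and `ℝ` with their order, and
every action is deterministic. So a history constraint describes one reachable configuration or is
unsatisfiable, and one argument covers all three domains.

If `f n = 0`, the program visits finitely many configurations and `m` stays bounded. There are
finitely many history constraints up to equivalence, and equivalence itself is a summary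
(`hasFiniteSummary_counterDDSA`). If `f n = 1`, configurations with `m = 0` and `z = k` are
reachable for every `k`. Exactly `k` consecutive drains are possible from such a configuration, so a
summary must separate all of them (`not_hasFiniteSummary_counterDDSA`).

The input `n` enters only as the initial value of one variable, so the code of the DDSA is
computable in `n`, and a decision procedure for finite summary would separate the two sets.
Inseparability, rather than the halting problem, is used because a diverging program need not force
infinitely many classes. Inputs where `f` is undefined then need no analysis. -/

theorem Expr.eval_rename {K D X Y : Type} [CommRing K] [CommRing D] [Algebra K D]
    (f : X → Y) (α : Y → D) (e : Expr K X) :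
    (e.rename f).eval α = e.eval (α ∘ f) := by
  induction e <;> simp_all [Expr.rename, Expr.eval]

/-! ### Semantics of renaming, conjunction and update. -/

section Semantics

variable {K D X Y : Type} [CommRing K] [CommRing D] [LinearOrder D] [Algebra K D]

theorem Constraint.sat_rename (f : X → Y) (α : Y → D) (c : Constraint K X) :
    (c.rename f).Sat α ↔ c.Sat (α ∘ f) := by
  induction c <;> simp_all [Constraint.rename, Constraint.Sat, Expr.eval_rename]

theorem Formula.sat_rename {m m' : ℕ} (f : Fin m → Fin m') (α : Fin m' → D) (φ : Formula K m) :
    (φ.rename f).Sat α ↔ φ.Sat (α ∘ f) := by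
  induction φ generalizing m' with
  | tru => simp [Formula.rename, Formula.Sat]
  | atom c => simp [Formula.rename, Formula.Sat, Constraint.sat_rename]
  | neg φ ih => simp [Formula.rename, Formula.Sat, ih]
  | and φ ψ ih₁ ih₂ => simp [Formula.rename, Formula.Sat, ih₁, ih₂]
  | or φ ψ ih₁ ih₂ => simp [Formula.rename, Formula.Sat, ih₁, ih₂]
  | ex k φ ih =>
    simp only [Formula.rename, Formula.Sat, ih]
    refine exists_congr fun u => iff_of_eq (congrArg (fun β => φ.Sat β) ?_)
    funext i
    refine Fin.addCases (fun i => ?_) (fun j => ?_) i <;> simp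

theorem Formula.sat_conj {m : ℕ} (α : Fin m → D) (l : List (Constraint K (Fin m))) :
    (Formula.conj l).Sat α ↔ ∀ c ∈ l, c.Sat α := by
  induction l <;> simp_all [Formula.conj, Formula.Sat]

theorem Formula.Equiv.satisfiable_iff {m : ℕ} {φ ψ : Formula K m} (h : φ.Equiv D ψ) :
    φ.Satisfiable D ↔ ψ.Satisfiable D :=
  exists_congr h

namespace DDSA

variable {S : DDSA K}

theorem sat_update (φ : Formula K S.numVars) (a : Fin S.numActions) (α : Fin S.numVars → D) :
    (S.update φ a).Sat α ↔
      ∃ u : Fin S.numVars → D, φ.Sat u ∧ ∀ c ∈ S.transition a, c.Sat (Sum.elim u α) := by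
  simp only [update, Formula.Sat, Formula.sat_rename, Formula.sat_conj, List.forall_mem_map,
    Constraint.sat_rename]
  refine exists_congr fun u => and_congr ?_ (forall₂_congr fun c _ => ?_)
  · refine iff_of_eq (congrArg (fun β => φ.Sat β) ?_)
    exact funext fun i => Fin.append_right α u i
  · refine iff_of_eq (congrArg (fun β => c.Sat β) ?_)
    funext i
    rcases i with i | i
    · exact Fin.append_right α u i
    · exact Fin.append_left α u i

theorem update_and_conj_congr {φ ψ : Formula K S.numVars} (h : φ.Equiv D ψ)
    (a : Fin S.numActions) (C : List (Constraint K (Fin S.numVars))) :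
    (Formula.and (S.update φ a) (Formula.conj C)).Equiv D
      (Formula.and (S.update ψ a) (Formula.conj C)) := by
  intro α
  have h' : ∀ u, φ.Sat u ↔ ψ.Sat u := h
  simp only [Formula.Sat, sat_update, h']

end DDSA

end Semantics

/-! ### Finite history sets give finite summaries -/

theorem _root_.Set.Finite.exists_computable_mem {s : Set ℕ} (hs : s.Finite) :
    ∃ f : ℕ → Bool, Computable f ∧ ∀ n, f n = true ↔ n ∈ s := by
  induction s, hs using Set.Finite.induction_on with
  | empty => exact ⟨fun _ => false, Computable.const _, by simp⟩
  | @insert a s _ _ ih =>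
    obtain ⟨f, hf, h⟩ := ih
    refine ⟨fun n => decide (n = a) || f n, ?_, by simp [h]⟩
    exact Primrec.or.to_comp.comp
      ((Primrec.eq.decide.comp Primrec.id (Primrec.const a)).to_comp) hf

/-- Finitely many codes can be put in a lookup table; the answer on numbers that are not codes is
irrelevant. -/
theorem _root_.AlgDecidable.of_finite {α : Type} [Coded α] [Finite α] (P : α → Prop) :
    AlgDecidable P := by
  obtain ⟨f, hf, h⟩ := ((Set.toFinite {x | P x}).image Coded.code).exists_computable_mem
  refine ⟨f, hf, fun x => ?_⟩
  rw [h, Coded.code_injective.mem_set_image]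
  rfl

namespace DDSA

variable {K : Type} (D : Type) [CommRing K] [CommRing D] [LinearOrder D] [Algebra K D]

/-- The pairs of a state and the solution set of a history constraint. -/
def historyStates (S : DDSA K) (𝒞 : List (Constraint K (Fin S.numVars))) :
    Set (Fin S.numStates × Set (Fin S.numVars → D)) :=
  {p | ∃ (σ : SymbolicRun S p.1) (C : ℕ → List (Constraint K (Fin S.numVars))),
    (∀ i, C i ⊆ 𝒞) ∧ {α | (hist C σ).Sat α} = p.2}

variable {D}

/-- One formula is chosen for each pair of a state and a solution set, so that only finitely many
formulas occur. Logical equivalence then serves as `∼`: it has finitely many classes and is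
decidable merely because the type is finite. -/
theorem hasFiniteSummary_of_finite [Coded K] {S : DDSA K}
    {𝒞 : List (Constraint K (Fin S.numVars))} (h : (S.historyStates D 𝒞).Finite) :
    S.HasFiniteSummary D 𝒞 := by
  classical
  have hrep : ∀ p ∈ S.historyStates D 𝒞, ∃ φ : Formula K S.numVars, {α | φ.Sat α} = p.2 := by
    rintro p ⟨σ, C, _, h⟩
    exact ⟨_, h⟩
  have : Nonempty (Formula K S.numVars) := ⟨Formula.tru⟩
  choose! rep hrep using hrep
  let Φ : Set (Fin S.numStates × Formula K S.numVars) :=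
    (fun p => (p.1, rep p)) '' S.historyStates D 𝒞
  have hΦ : Φ.Finite := h.image _
  have : Finite (FormulasOf Φ) := by
    refine Set.Finite.subset (hΦ.image Prod.snd) ?_
    rintro φ ⟨b, hb⟩
    exact ⟨_, hb, rfl⟩
  let r : Setoid (FormulasOf Φ) :=
    { r := fun φ ψ => φ.1.Equiv D ψ.1
      iseqv := ⟨fun _ _ => Iff.rfl, fun h α => (h α).symm, fun h h' α => (h α).trans (h' α)⟩ }
  refine ⟨Φ, r, ⟨⟨?_, ?_⟩, fun _ _ h => h, AlgDecidable.of_finite _, ?_, ?_⟩, inferInstance⟩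
  · intro b σ C hC
    have hmem : (b, {α | (hist C σ).Sat α}) ∈ S.historyStates D 𝒞 := ⟨σ, C, hC, rfl⟩
    exact ⟨_, ⟨_, hmem, rfl⟩, fun α => (Set.ext_iff.mp (hrep _ hmem) α).symm⟩
  · rintro b φ ⟨p, hp, he⟩
    obtain ⟨rfl, rfl⟩ := Prod.mk.inj he
    obtain ⟨σ, C, hC, h⟩ := id hp
    exact ⟨σ, C, hC, fun α => Set.ext_iff.mp (h.trans (hrep p hp).symm) α⟩
  · intro b φ ψ _ _ h
    exact Formula.Equiv.satisfiable_iff h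
  · intro b φ ψ _ _ h a C _ φ' ψ' _ _ h₁ h₂ α
    exact (h₁ α).trans ((update_and_conj_congr h a C α).trans (h₂ α).symm)

/-! ### Summaries preserve satisfiability along action sequences. -/

/-- The extension of a symbolic run by a list of actions. -/
def SymbolicRun.extend {S : DDSA K} : {b : Fin S.numStates} → SymbolicRun S b →
    List (Fin S.numActions) → Σ b', SymbolicRun S b'
  | b, σ, [] => ⟨b, σ⟩
  | _, σ, a :: l => (σ.step a).extend l

/-- Related history constraints are equisatisfiable along all extensions of their runs. -/
theorem IsSummary.satisfiable_extend_iff [Coded K] {S : DDSA K}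
    {𝒞 : List (Constraint K (Fin S.numVars))}
    {Φ : Set (Fin S.numStates × Formula K S.numVars)} {r : Setoid (FormulasOf Φ)}
    (h : S.IsSummary D 𝒞 Φ r) (l : List (Fin S.numActions)) :
    ∀ {b : Fin S.numStates} (σ τ : SymbolicRun S b) (φ ψ : FormulasOf Φ),
      (b, φ.1) ∈ Φ → (b, ψ.1) ∈ Φ → (hist (fun _ => []) σ).Equiv D φ.1 →
      (hist (fun _ => []) τ).Equiv D ψ.1 → r φ ψ →
      ((hist (fun _ => []) (σ.extend l).2).Satisfiable D ↔
        (hist (fun _ => []) (τ.extend l).2).Satisfiable D) := by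
  induction l with
  | nil =>
    intro b σ τ φ ψ hφ hψ hσ hτ hr
    exact (Formula.Equiv.satisfiable_iff hσ).trans
      ((h.equisatisfiable b φ ψ hφ hψ hr).trans (Formula.Equiv.satisfiable_iff hτ).symm)
  | cons a l ih =>
    intro b σ τ φ ψ hφ hψ hσ hτ hr
    -- The history constraints themselves need not lie in `Φ`, so the induction carries
    -- representatives and equivalences to them.
    obtain ⟨φ', hφ', hσ'⟩ := h.historySet.1 _ (σ.step a) (fun _ => []) (by simp)
    obtain ⟨ψ', hψ', hτ'⟩ := h.historySet.1 _ (τ.step a) (fun _ => []) (by simp)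
    refine ih (σ.step a) (τ.step a) ⟨φ', _, hφ'⟩ ⟨ψ', _, hψ'⟩ hφ' hψ' hσ' hτ' ?_
    refine h.update_congr b φ ψ hφ hψ hr a [] (by simp) _ _ hφ' hψ' ?_ ?_
    · exact fun α => (hσ' α).symm.trans (update_and_conj_congr hσ a [] α)
    · exact fun α => (hτ' α).symm.trans (update_and_conj_congr hτ a [] α)

end DDSA

end DDSAs

namespace DDSAs

/-! ### Counter systems -/

/-- A term `c` or `x + c` over natural-number counters. -/
inductive CounterTerm (X : Type) : Type
  | lit (c : ℕ)
  | shift (x : X) (c : ℕ)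

/-- A comparison of two counter terms. -/
inductive CounterTest (X : Type) : Type
  | eq (s t : CounterTerm X)
  | ne (s t : CounterTerm X)
  | lt (s t : CounterTerm X)

/-- A guarded simultaneous assignment to all counters. -/
structure CounterAction (X : Type) where
  tests : List (CounterTest X)
  assign : X → CounterTerm X

namespace CounterTerm

variable {X : Type}

def val (x : X → ℕ) : CounterTerm X → ℕ
  | lit c => c
  | shift v c => x v + c

def toExpr (K : Type) [CommRing K] {Y : Type} (f : X → Y) : CounterTerm X → Expr K Y
  | lit c => Expr.const (c : K)
  | shift v c => Expr.add (Expr.var (f v)) (Expr.const (c : K))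

theorem eval_toExpr {K D Y : Type} [CommRing K] [CommRing D] [Algebra K D] (f : X → Y)
    (x : X → ℕ) (α : Y → D) (h : ∀ v, α (f v) = x v) (t : CounterTerm X) :
    (t.toExpr K f).eval α = (t.val x : D) := by
  cases t <;> simp [toExpr, val, Expr.eval, h]

end CounterTerm

namespace CounterTest

variable {X : Type}

def Holds (x : X → ℕ) : CounterTest X → Prop
  | eq s t => s.val x = t.val x
  | ne s t => s.val x ≠ t.val x
  | lt s t => s.val x < t.val x

def toConstraint (K : Type) [CommRing K] {Y : Type} (f : X → Y) : CounterTest X → Constraint K Y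
  | eq s t => Constraint.eq (s.toExpr K f) (t.toExpr K f)
  | ne s t => Constraint.ne (s.toExpr K f) (t.toExpr K f)
  | lt s t => Constraint.lt (s.toExpr K f) (t.toExpr K f)

theorem sat_toConstraint {K D Y : Type} [CommRing K] [CommRing D] [LinearOrder D]
    [IsStrictOrderedRing D] [Algebra K D] (f : X → Y) (x : X → ℕ) (α : Y → D)
    (h : ∀ v, α (f v) = x v) (t : CounterTest X) :
    (t.toConstraint K f).Sat α ↔ t.Holds x := by
  cases t <;> simp [toConstraint, Holds, Constraint.Sat, CounterTerm.eval_toExpr f x α h]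

end CounterTest

/-- The conjunction of a list of constraints as a single constraint. -/
def Constraint.all {K X : Type} [CommRing K] : List (Constraint K X) → Constraint K X
  | [] => Constraint.eq (Expr.const 0) (Expr.const 0)
  | c :: l => Constraint.and c (Constraint.all l)

theorem Constraint.sat_all {K D X : Type} [CommRing K] [CommRing D] [LinearOrder D] [Algebra K D]
    (α : X → D) (l : List (Constraint K X)) :
    (Constraint.all l).Sat α ↔ ∀ c ∈ l, c.Sat α := by
  induction l <;> simp_all [Constraint.all, Constraint.Sat]

theorem Constraint.occurs_all {K X : Type} [CommRing K] {v : X} {l : List (Constraint K X)}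
    {c : Constraint K X} (hc : c ∈ l) (h : c.Occurs v) : (Constraint.all l).Occurs v := by
  induction l with
  | nil => simp at hc
  | cons d l ih =>
    rcases List.mem_cons.mp hc with rfl | hc
    · exact Or.inl h
    · exact Or.inr (ih hc)

namespace CounterAction

variable {V : ℕ}

def Enabled (a : CounterAction (Fin V)) (x : Fin V → ℕ) : Prop := ∀ t ∈ a.tests, t.Holds x

def next (a : CounterAction (Fin V)) (x : Fin V → ℕ) : Fin V → ℕ := fun v => (a.assign v).val x

def guard (K : Type) [CommRing K] (a : CounterAction (Fin V)) :
    Constraint K (Fin V ⊕ Fin V) :=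
  Constraint.all (a.tests.map (CounterTest.toConstraint K Sum.inl) ++
    (List.finRange V).map (fun v =>
      Constraint.eq (Expr.var (Sum.inr v)) ((a.assign v).toExpr K Sum.inl)))

theorem occurs_guard (K : Type) [CommRing K] (a : CounterAction (Fin V)) (v : Fin V) :
    (a.guard K).Occurs (Sum.inr v) :=
  Constraint.occurs_all (List.mem_append_right _ (List.mem_map_of_mem (List.mem_finRange v)))
    (Or.inl rfl)

/-- Started from natural-number values, the guard forces the written values to be the natural
numbers of the next configuration, so no other elements of `D` ever appear. -/
theorem sat_guard {K D : Type} [CommRing K] [CommRing D] [LinearOrder D]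
    [IsStrictOrderedRing D] [Algebra K D] (a : CounterAction (Fin V)) (x : Fin V → ℕ)
    (α : Fin V → D) :
    (a.guard K).Sat (Sum.elim (fun v => (x v : D)) α) ↔
      a.Enabled x ∧ α = fun v => (a.next x v : D) := by
  simp only [guard, Constraint.sat_all, List.mem_append, or_imp, forall_and, List.forall_mem_map]
  refine and_congr (forall₂_congr fun t _ => ?_) ?_
  · exact CounterTest.sat_toConstraint (K := K) Sum.inl x _ (fun _ => rfl) t
  · simp only [List.mem_finRange, true_imp_iff, Constraint.Sat]
    rw [funext_iff]
    refine forall_congr' fun v => ?_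
    rw [CounterTerm.eval_toExpr Sum.inl x _ (fun _ => rfl)]
    rfl

end CounterAction

variable {V : ℕ}

/-- The transition relation of a list of actions. -/
def CounterStep (acts : List (CounterAction (Fin V))) (x y : Fin V → ℕ) : Prop :=
  ∃ a ∈ acts, a.Enabled x ∧ y = a.next x

/-- The DDSA with a single state that executes a list of counter actions. -/
abbrev counterDDSA (K : Type) [CommRing K] (acts : List (CounterAction (Fin V))) (x₀ : Fin V → ℕ) :
    DDSA K where
  numStates := 1
  numActions := acts.length
  numVars := V
  init := 0
  trans := fun _ _ => 0
  final := fun _ => true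
  initVal := fun v => (x₀ v : K)
  guard := fun a => (acts.get a).guard K

open DDSA Relation

/-! ### History constraints of counter systems. -/

section CounterDDSA

variable {K D : Type} [CommRing K] [CommRing D] [LinearOrder D]
  [Algebra K D] {acts : List (CounterAction (Fin V))} {x₀ : Fin V → ℕ}

/-- A counter action assigns every counter, so no frame condition `v^w = v^r` is added. -/
theorem counterDDSA_transition (a : Fin acts.length) :
    (counterDDSA K acts x₀).transition a = [(acts.get a).guard K] := by
  refine congrArg (List.cons _) ?_
  rw [List.map_eq_nil_iff, List.filter_eq_nil_iff]
  intro v _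
  rw [Bool.not_eq_true, decide_eq_false_iff_not, not_not]
  exact (acts.get a).occurs_guard K v

theorem sat_hist_start (α : Fin V → D) :
    (hist (fun _ => []) (SymbolicRun.start (S := counterDDSA K acts x₀))).Sat α ↔
      α = fun v => (x₀ v : D) := by
  simp only [hist, List.append_nil, Formula.sat_conj, initConstraints, List.forall_mem_map,
    List.mem_finRange, true_imp_iff, Constraint.Sat, Expr.eval]
  rw [funext_iff]
  exact forall_congr' fun v => by simp

theorem sat_hist_step {b : Fin 1} (σ : SymbolicRun (counterDDSA K acts x₀) b)
    (a : Fin acts.length) (α : Fin V → D) :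
    (hist (fun _ => []) (σ.step a)).Sat α ↔ ∃ u : Fin V → D, (hist (fun _ => []) σ).Sat u ∧
      ((acts.get a).guard K).Sat (Sum.elim u α) := by
  have h := sat_update (S := counterDDSA K acts x₀) (hist (fun _ => []) σ) a α
  rw [counterDDSA_transition] at h
  simp only [List.mem_singleton, forall_eq] at h
  simp only [hist, Formula.Sat, Formula.conj, and_true]
  exact h

/-- The history constraint of `σ` describes the single configuration `x`. -/
def Describes (D : Type) [CommRing D] [LinearOrder D] [Algebra K D] {b : Fin 1}
    (σ : SymbolicRun (counterDDSA K acts x₀) b) (x : Fin V → ℕ) : Prop :=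
  ∀ α : Fin V → D, (hist (fun _ => []) σ).Sat α ↔ α = fun v => (x v : D)

theorem Describes.satisfiable {b : Fin 1} {σ : SymbolicRun (counterDDSA K acts x₀) b}
    {x : Fin V → ℕ} (h : Describes D σ x) : (hist (fun _ => []) σ).Satisfiable D :=
  ⟨_, (h _).mpr rfl⟩

theorem not_satisfiable_extend (l : List (Fin acts.length)) :
    ∀ {b : Fin 1} (σ : SymbolicRun (counterDDSA K acts x₀) b),
      ¬ (hist (fun _ => []) σ).Satisfiable D →
      ¬ (hist (fun _ => []) (σ.extend l).2).Satisfiable D := by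
  induction l with
  | nil => exact fun _ h => h
  | cons a l ih =>
    refine fun σ h => ih (σ.step a) ?_
    rintro ⟨α, hα⟩
    obtain ⟨u, hu, -⟩ := (sat_hist_step σ a α).mp hα
    exact h ⟨u, hu⟩

variable [IsStrictOrderedRing D]

theorem Describes.sat_hist_step {b : Fin 1} {σ : SymbolicRun (counterDDSA K acts x₀) b}
    {x : Fin V → ℕ} (h : Describes D σ x) (a : Fin acts.length) (α : Fin V → D) :
    (hist (fun _ => []) (σ.step a)).Sat α ↔
      (acts.get a).Enabled x ∧ α = fun v => ((acts.get a).next x v : D) := by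
  rw [DDSAs.sat_hist_step, ← CounterAction.sat_guard (K := K)]
  constructor
  · rintro ⟨u, hu, hg⟩
    rwa [(h u).mp hu] at hg
  · exact fun hg => ⟨_, (h _).mpr rfl, hg⟩

/-- Actions are deterministic: from a single configuration an enabled action leads to a single one,
and a disabled action makes the constraint unsatisfiable for good. -/
theorem describes_or_unsat {b : Fin (counterDDSA K acts x₀).numStates}
    (σ : SymbolicRun (counterDDSA K acts x₀) b) :
    (∃ x, ReflTransGen (CounterStep acts) x₀ x ∧ Describes D σ x) ∨
      ∀ α : Fin V → D, ¬ (hist (fun _ => []) σ).Sat α := by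
  induction σ with
  | start => exact Or.inl ⟨x₀, ReflTransGen.refl, sat_hist_start⟩
  | step σ a ih =>
    rcases ih with ⟨x, hx, h⟩ | h
    · by_cases ha : (acts.get a).Enabled x
      · refine Or.inl ⟨_, hx.tail ⟨_, List.get_mem _ a, ha, rfl⟩, fun α => ?_⟩
        exact (h.sat_hist_step a α).trans (and_iff_right ha)
      · exact Or.inr fun α hα => ha ((h.sat_hist_step a α).mp hα).1
    · refine Or.inr fun α hα => ?_
      obtain ⟨u, hu, -⟩ := (sat_hist_step σ a α).mp hα
      exact h u hu

theorem exists_describes {x : Fin V → ℕ} (hx : ReflTransGen (CounterStep acts) x₀ x) :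
    ∃ σ : SymbolicRun (counterDDSA K acts x₀) (0 : Fin 1), Describes D σ x := by
  induction hx with
  | refl => exact ⟨SymbolicRun.start, sat_hist_start⟩
  | tail _ hs ih =>
    obtain ⟨σ, h⟩ := ih
    obtain ⟨a, ha, hen, rfl⟩ := hs
    obtain ⟨i, rfl⟩ := List.get_of_mem ha
    exact ⟨σ.step i, fun α => (h.sat_hist_step i α).trans (and_iff_right hen)⟩

/-- Since `𝒞` is empty, the only solution sets are the singletons of reachable configurations and
the empty set. -/
theorem hasFiniteSummary_counterDDSA [Coded K]
    (h : {x | ReflTransGen (CounterStep acts) x₀ x}.Finite) :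
    (counterDDSA K acts x₀).HasFiniteSummary D [] := by
  refine hasFiniteSummary_of_finite ?_
  refine ((h.image fun x => ((0 : Fin 1), ({fun v => (x v : D)} : Set (Fin V → D)))).union
    (Set.finite_singleton ((0 : Fin 1), (∅ : Set (Fin V → D))))).subset ?_
  rintro ⟨b, X⟩ ⟨σ, C, hC, hX⟩
  obtain rfl : C = fun _ => [] := funext fun i => List.subset_nil.mp (hC i)
  have hb : b = (0 : Fin 1) := Subsingleton.elim (α := Fin 1) _ _
  rcases describes_or_unsat (D := D) σ with ⟨x, hx, hσ⟩ | hσ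
  · exact Or.inl ⟨x, hx, Prod.ext hb.symm ((Set.ext fun α => (hσ α).symm).trans hX)⟩
  · exact Or.inr (Prod.ext hb (hX.symm.trans (Set.eq_empty_iff_forall_notMem.mpr hσ)))

/-- If an action `d` counts `m` up to `z`, it can be executed `z - m` times. -/
theorem satisfiable_extend_replicate {z m : Fin V} {d : Fin acts.length}
    (hen : ∀ x, (acts.get d).Enabled x ↔ x m < x z)
    (hz : ∀ x, (acts.get d).next x z = x z) (hm : ∀ x, (acts.get d).next x m = x m + 1)
    (j : ℕ) : ∀ {b : Fin 1} (σ : SymbolicRun (counterDDSA K acts x₀) b) (x : Fin V → ℕ),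
      Describes D σ x → x m ≤ x z →
      ((hist (fun _ => []) (σ.extend (List.replicate j d)).2).Satisfiable D ↔
        x m + j ≤ x z) := by
  induction j with
  | zero => exact fun σ x h hle => iff_of_true h.satisfiable hle
  | succ j ih =>
    intro b σ x h hle
    rw [List.replicate_succ]
    by_cases hlt : x m < x z
    · have := ih (σ.step d) ((acts.get d).next x)
        (fun α => (h.sat_hist_step d α).trans (and_iff_right ((hen x).mpr hlt)))
        (by rw [hz, hm]; exact hlt)
      rw [hz, hm] at this
      exact this.trans (by omega)
    · refine iff_of_false (not_satisfiable_extend (List.replicate j d) (σ.step d) ?_) (by omega)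
      rintro ⟨α, hα⟩
      exact hlt ((hen x).mp ((h.sat_hist_step d α).mp hα).1)

/-- With finitely many classes, two configurations with `m = 0` and distinct values `k`, `l` of `z`
would be related. But `j` executions of `d` are possible from the first iff `j ≤ k`, from the second
iff `j ≤ l`. -/
theorem not_hasFiniteSummary_counterDDSA [Coded K] {z m : Fin V} {d : CounterAction (Fin V)}
    (hd : d ∈ acts) (hen : ∀ x, d.Enabled x ↔ x m < x z)
    (hz : ∀ x, d.next x z = x z) (hm : ∀ x, d.next x m = x m + 1)
    (h : ∀ k, ∃ x, ReflTransGen (CounterStep acts) x₀ x ∧ x z = k ∧ x m = 0) :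
    ¬ (counterDDSA K acts x₀).HasFiniteSummary D [] := by
  rintro ⟨Φ, r, hsum, hfin⟩
  obtain ⟨d, rfl⟩ := List.get_of_mem hd
  choose x hx hxz hxm using h
  choose σ hσ using fun k => exists_describes (K := K) (D := D) (hx k)
  choose φ hφ hφσ using fun k => hsum.historySet.1 _ (σ k) (fun _ => []) (by simp)
  obtain ⟨k, l, hkl, he⟩ := Finite.exists_ne_map_eq_of_infinite
    (fun k => Quotient.mk r ⟨φ k, _, hφ k⟩)
  have key := hsum.satisfiable_extend_iff
  have hiff : ∀ j, j ≤ k ↔ j ≤ l := by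
    intro j
    have := key (List.replicate j d) (σ k) (σ l) _ _ (hφ k) (hφ l) (hφσ k) (hφσ l)
      (Quotient.exact he)
    rw [satisfiable_extend_replicate hen hz hm j _ _ (hσ k) (by rw [hxm]; omega),
      satisfiable_extend_replicate hen hz hm j _ _ (hσ l) (by rw [hxm]; omega)] at this
    simpa [hxm, hxz] using this
  exact hkl (le_antisymm ((hiff k).mp le_rfl) ((hiff l).mpr le_rfl))

end CounterDDSA

end DDSAs

namespace DDSAs

open Relation

/-! ### Structured register programs -/

/-- Programs over registers indexed by `ℕ`; `loop x y P` repeats `P` as long as the registers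
`x` and `y` differ. -/
inductive RegProg : Type
  | assign (o : ℕ) (t : CounterTerm ℕ)
  | seq (P Q : RegProg)
  | loop (x y : ℕ) (P : RegProg)

namespace RegProg

/-- A configuration: the programs that remain to be executed, and the register contents. -/
abbrev Cfg : Type := List RegProg × (ℕ → ℕ)

/-- A loop stays on the stack below its body, so the stacks themselves act as control points and
only finitely many of them arise from one program. -/
inductive Step : Cfg → Cfg → Prop
  | assign (o t K s) : Step (assign o t :: K, s) (K, Function.update s o (t.val s))
  | seq (P Q K s) : Step (seq P Q :: K, s) (P :: Q :: K, s)
  | exit (x y P K) (s : ℕ → ℕ) (h : s x = s y) : Step (loop x y P :: K, s) (K, s)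
  | enter (x y P K) (s : ℕ → ℕ) (h : s x ≠ s y) :
      Step (loop x y P :: K, s) (P :: loop x y P :: K, s)

theorem Step.unique {c c₁ c₂ : Cfg} (h₁ : Step c c₁) (h₂ : Step c c₂) : c₁ = c₂ := by
  cases h₁ <;> cases h₂ <;> first | rfl | contradiction

/-- `P` terminates when started in `s`, and the final register contents are `s'`. -/
def Exec (P : RegProg) (s s' : ℕ → ℕ) : Prop :=
  ∀ K, ReflTransGen Step (P :: K, s) (K, s')

theorem exec_assign (o : ℕ) (t : CounterTerm ℕ) (s : ℕ → ℕ) :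
    Exec (assign o t) s (Function.update s o (t.val s)) :=
  fun K => ReflTransGen.single (Step.assign o t K s)

/-- The quantification over all continuations in `Exec` is what allows the first program to run on
top of the second. -/
theorem Exec.seq {P Q : RegProg} {s s' s'' : ℕ → ℕ} (h : Exec P s s') (h' : Exec Q s' s'') :
    Exec (seq P Q) s s'' :=
  fun K => ReflTransGen.head (Step.seq P Q K s) ((h (Q :: K)).trans (h' K))

theorem exec_loop_exit {x y : ℕ} {P : RegProg} {s : ℕ → ℕ} (h : s x = s y) :
    Exec (loop x y P) s s :=
  fun K => ReflTransGen.single (Step.exit x y P K s h)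

theorem Exec.loop {x y : ℕ} {P : RegProg} {s s' s'' : ℕ → ℕ} (hne : s x ≠ s y)
    (h : Exec P s s') (h' : Exec (loop x y P) s' s'') : Exec (loop x y P) s s'' :=
  fun K => ReflTransGen.head (Step.enter x y P K s hne) ((h _).trans (h' K))

/-- `P` computes `f` from the registers `rs` into `o`, and changes no other register below `b`. -/
def Computes {n : ℕ} (P : RegProg) (f : List.Vector ℕ n →. ℕ) (rs : Fin n → ℕ) (o b : ℕ) : Prop :=
  ∀ (s : ℕ → ℕ) (v : List.Vector ℕ n) (y : ℕ), (∀ i, s (rs i) = v.get i) → y ∈ f v →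
    ∃ s', Exec P s s' ∧ s' o = y ∧ ∀ i < b, i ≠ o → s' i = s i

/-- `f` is computed by a program, for every choice of input and output registers. -/
def Computable {n : ℕ} (f : List.Vector ℕ n →. ℕ) : Prop :=
  ∀ (rs : Fin n → ℕ) (o b : ℕ), (∀ i, rs i < b) → o < b → ∃ P, Computes P f rs o b

/-! ### Partial recursive functions are computed by register programs. -/

theorem computable_zero : Computable (n := 0) (fun _ => Part.some 0) := by
  intro rs o b _ _
  refine ⟨assign o (.lit 0), fun s v y _ hy => ⟨_, exec_assign _ _ _, ?_, ?_⟩⟩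
  · simpa [CounterTerm.val] using (Part.mem_some_iff.mp hy).symm
  · intro i _ hi
    simp [hi]

theorem computable_succ : Computable (n := 1) (fun v => Part.some (v.head + 1)) := by
  intro rs o b _ _
  refine ⟨assign o (.shift (rs 0) 1), fun s v y hv hy => ⟨_, exec_assign _ _ _, ?_, ?_⟩⟩
  · rw [Part.mem_some_iff.mp hy]
    simp [CounterTerm.val, hv]
  · intro i _ hi
    simp [hi]

theorem computable_get {n : ℕ} (i : Fin n) : Computable (fun v => Part.some (v.get i)) := by
  intro rs o b _ _
  refine ⟨assign o (.shift (rs i) 0), fun s v y hv hy => ⟨_, exec_assign _ _ _, ?_, ?_⟩⟩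
  · rw [Part.mem_some_iff.mp hy]
    simp [CounterTerm.val, hv]
  · intro i _ hi
    simp [hi]

/-- Evaluation of the first `k` of `n` functions into the registers `b, b + 1, …`. -/
theorem exists_evalAll {m n : ℕ} {g : Fin n → List.Vector ℕ m →. ℕ} (hg : ∀ i, Computable (g i))
    (rs : Fin m → ℕ) (b : ℕ) (hrs : ∀ i, rs i < b) (k : ℕ) (hk : k ≤ n) :
    ∃ P, ∀ (s : ℕ → ℕ) (v : List.Vector ℕ m) (ys : Fin n → ℕ), (∀ i, s (rs i) = v.get i) →
      (∀ i, ys i ∈ g i v) → ∃ s', Exec P s s' ∧ (∀ i < b, s' i = s i) ∧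
        ∀ i : Fin n, i.val < k → s' (b + i) = ys i := by
  induction k with
  | zero =>
    -- There is no empty program; clearing the scratch register `b` takes its place.
    refine ⟨assign b (.lit 0), fun s v ys _ _ => ⟨_, exec_assign _ _ _, ?_, by simp⟩⟩
    intro i hi
    simp [hi.ne]
  | succ k ih =>
    obtain ⟨P, hP⟩ := ih (by omega)
    -- The bound `b + n` protects the values already stored in `b, …, b + k - 1`.
    obtain ⟨Q, hQ⟩ := hg ⟨k, hk⟩ rs (b + k) (b + n)
      (fun i => (hrs i).trans_le (Nat.le_add_right _ _)) (by omega)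
    refine ⟨seq P Q, fun s v ys hv hys => ?_⟩
    obtain ⟨s₁, h₁, hb₁, hy₁⟩ := hP s v ys hv hys
    obtain ⟨s₂, h₂, ho, hb₂⟩ := hQ s₁ v (ys ⟨k, hk⟩) (fun i => by rw [hb₁ _ (hrs i), hv])
      (hys _)
    refine ⟨s₂, h₁.seq h₂, fun i hi => ?_, fun i hi => ?_⟩
    · rw [hb₂ i (by omega) (by omega), hb₁ i hi]
    · rcases Nat.lt_succ_iff_lt_or_eq.mp hi with hi | hi
      · rw [hb₂ _ (by omega) (by omega), hy₁ i hi]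
      · obtain rfl : i = ⟨k, hk⟩ := Fin.ext hi
        exact ho

/-- Stated with an inclusion `hh` instead of an equation, so that it serves both the total
composition of `Nat.Primrec'` and the partial one of `Nat.Partrec'`. -/
theorem computable_comp {m n : ℕ} {f : List.Vector ℕ n →. ℕ} {g : Fin n → List.Vector ℕ m →. ℕ}
    (hf : Computable f) (hg : ∀ i, Computable (g i)) {h : List.Vector ℕ m →. ℕ}
    (hh : ∀ v, ∀ y ∈ h v, ∃ ys : List.Vector ℕ n, (∀ i, ys.get i ∈ g i v) ∧ y ∈ f ys) :
    Computable h := by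
  intro rs o b hrs ho
  obtain ⟨P, hP⟩ := exists_evalAll hg rs b hrs n le_rfl
  obtain ⟨Q, hQ⟩ := hf (fun i => b + i) o (b + n) (fun i => by omega) (by omega)
  refine ⟨seq P Q, fun s v y hv hy => ?_⟩
  obtain ⟨ys, hys, hy⟩ := hh v y hy
  obtain ⟨s₁, h₁, hb₁, hy₁⟩ := hP s v ys.get hv hys
  obtain ⟨s₂, h₂, ho₂, hb₂⟩ := hQ s₁ ys y (fun i => hy₁ i i.2) hy
  exact ⟨s₂, h₁.seq h₂, ho₂, fun i hi hio => by rw [hb₂ i (by omega) hio, hb₁ i hi]⟩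

/-- `b` is the accumulator, `b + 1` the loop counter. -/
theorem computable_prec {n : ℕ} {f : List.Vector ℕ n → ℕ} {g : List.Vector ℕ (n + 2) → ℕ}
    (hf : Computable fun v => Part.some (f v)) (hg : Computable fun v => Part.some (g v)) :
    Computable fun v : List.Vector ℕ (n + 1) =>
      Part.some (v.head.rec (f v.tail) fun y IH => g (y ::ᵥ IH ::ᵥ v.tail)) := by
  intro rs o b hrs ho
  obtain ⟨P, hP⟩ := hf (fun i => rs i.succ) b (b + 2) (fun i => by have := hrs i.succ; omega)
    (by omega)
  -- The accumulator `b` is both an input and the output of `Q`, which `Computable` permits; the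
  -- bound `b + 2` protects the loop counter.
  obtain ⟨Q, hQ⟩ := hg (Fin.cons (b + 1) (Fin.cons b fun i => rs i.succ)) b (b + 2)
    (by
      refine Fin.cases (by simp) (Fin.cases (by simp) fun i => ?_)
      have := hrs i.succ
      simp only [Fin.cons_succ]
      omega) (by omega)
  -- Loop invariant: after `k` rounds `b` holds the `k`-th value of the recursion. The induction is
  -- on the number `j` of remaining rounds.
  have hloop : ∀ (v : List.Vector ℕ (n + 1)) (j k : ℕ) (s : ℕ → ℕ), k + j = v.head →
      (∀ i, s (rs i) = v.get i) → s (b + 1) = k →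
      s b = k.rec (f v.tail) (fun y IH => g (y ::ᵥ IH ::ᵥ v.tail)) →
      ∃ s', Exec (loop (b + 1) (rs 0) (seq Q (assign (b + 1) (.shift (b + 1) 1)))) s s' ∧
        s' b = v.head.rec (f v.tail) (fun y IH => g (y ::ᵥ IH ::ᵥ v.tail)) ∧
        ∀ i < b, s' i = s i := by
    intro v j
    induction j with
    | zero =>
      intro k s hk hv hs hb
      refine ⟨s, exec_loop_exit ?_, ?_, fun _ _ => rfl⟩
      · rw [hs, hv, List.Vector.get_zero, ← hk, Nat.add_zero]
      · rw [hb, ← hk]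
        rfl
    | succ j ih =>
      intro k s hk hv hs hb
      obtain ⟨s₁, h₁, ho₁, hb₁⟩ := hQ s (k ::ᵥ s b ::ᵥ v.tail) _
        (by
          refine Fin.cases (by simpa using hs) (Fin.cases rfl fun i => ?_)
          simp [hv])
        (Part.mem_some _)
      have hlt : ∀ i < b, Function.update s₁ (b + 1) (s₁ (b + 1) + 1) i = s i := by
        intro i hi
        rw [Function.update_of_ne (by omega), hb₁ i (by omega) (by omega)]
      obtain ⟨s₂, h₂, ho₂, hb₂⟩ := ih (k + 1)
        (Function.update s₁ (b + 1) (s₁ (b + 1) + 1)) (by omega)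
        (fun i => by rw [hlt _ (hrs i), hv])
        (by rw [Function.update_self, hb₁ _ (by omega) (by omega), hs])
        (by rw [Function.update_of_ne (by omega), ho₁, hb])
      refine ⟨s₂, Exec.loop ?_ (h₁.seq (exec_assign _ _ _)) h₂, ho₂, fun i hi => ?_⟩
      · rw [hs, hv, List.Vector.get_zero]
        omega
      · rw [hb₂ i hi, hlt i hi]
  -- The register `o` is written only at the end, since it may be one of the inputs that the loop
  -- still reads.
  refine ⟨seq P (seq (assign (b + 1) (.lit 0))
    (seq (loop (b + 1) (rs 0) (seq Q (assign (b + 1) (.shift (b + 1) 1))))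
      (assign o (.shift b 0)))), fun s v y hv hy => ?_⟩
  obtain ⟨s₁, h₁, ho₁, hb₁⟩ := hP s v.tail _ (fun i => by simp [hv]) (Part.mem_some _)
  have hlt : ∀ i < b, Function.update s₁ (b + 1) 0 i = s i := by
    intro i hi
    rw [Function.update_of_ne (by omega), hb₁ i (by omega) (by omega)]
  obtain ⟨s₂, h₂, ho₂, hb₂⟩ := hloop v v.head 0 (Function.update s₁ (b + 1) 0) (by omega)
    (fun i => by rw [hlt _ (hrs i), hv]) (by simp)
    (by rw [Function.update_of_ne (by omega), ho₁]; rfl)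
  refine ⟨_, h₁.seq ((exec_assign _ _ _).seq (h₂.seq (exec_assign _ _ _))), ?_, ?_⟩
  · rw [Part.mem_some_iff.mp hy, ← ho₂]
    simp [CounterTerm.val]
  · intro i hi hio
    rw [Function.update_of_ne hio, hb₂ i hi, hlt i hi]

/-- `b` is the candidate, `b + 1` the value at the candidate, `b + 2` is zero. -/
theorem computable_rfind {n : ℕ} {f : List.Vector ℕ (n + 1) → ℕ}
    (hf : Computable fun v => Part.some (f v)) :
    Computable fun v : List.Vector ℕ n => Nat.rfind fun k => Part.some (f (k ::ᵥ v) = 0) := by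
  intro rs o b hrs ho
  obtain ⟨P, hP⟩ := hf (Fin.cons b rs) (b + 1) (b + 3)
    (by
      refine Fin.cases (by simp) fun i => ?_
      have := hrs i
      simp only [Fin.cons_succ]
      omega) (by omega)
  have hstep : ∀ (v : List.Vector ℕ n) (k : ℕ) (s : ℕ → ℕ), (∀ i, s (rs i) = v.get i) →
      s b = k → s (b + 2) = 0 → ∃ s', Exec P s s' ∧ s' b = k ∧ s' (b + 1) = f (k ::ᵥ v) ∧
        s' (b + 2) = 0 ∧ ∀ i < b, s' i = s i := by
    intro v k s hv hk hz
    obtain ⟨s', h, ho, hb⟩ := hP s (k ::ᵥ v) _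
      (by
        refine Fin.cases (by simpa using hk) fun i => ?_
        simp [hv]) (Part.mem_some _)
    exact ⟨s', h, by rw [hb b (by omega) (by omega), hk], ho,
      by rw [hb _ (by omega) (by omega), hz], fun i hi => hb i (by omega) (by omega)⟩
  -- The induction is on the distance `j` from the candidate `k` to the least zero `y`.
  have hloop : ∀ (v : List.Vector ℕ n) (y j k : ℕ) (s : ℕ → ℕ), k + j = y →
      f (y ::ᵥ v) = 0 → (∀ i < y, f (i ::ᵥ v) ≠ 0) → (∀ i, s (rs i) = v.get i) → s b = k →
      s (b + 1) = f (k ::ᵥ v) → s (b + 2) = 0 →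
      ∃ s', Exec (loop (b + 1) (b + 2) (seq (assign b (.shift b 1)) P)) s s' ∧ s' b = y ∧
        ∀ i < b, s' i = s i := by
    intro v y j
    induction j with
    | zero =>
      intro k s hk hy _ _ hb hb₁ hb₂
      rw [Nat.add_zero] at hk
      subst hk
      exact ⟨s, exec_loop_exit (by rw [hb₁, hb₂, hy]), hb, fun _ _ => rfl⟩
    | succ j ih =>
      intro k s hk hy hlt hv hb hb₁ hb₂
      have hs : ∀ i, i ≠ b → Function.update s b (s b + 1) i = s i := by
        intro i hi
        rw [Function.update_of_ne hi]
      obtain ⟨s₁, h₁, he₀, he₁, he₂, hl⟩ := hstep v (k + 1) (Function.update s b (s b + 1))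
        (fun i => by rw [hs _ (hrs i).ne, hv]) (by simp [hb]) (by rw [hs _ (by omega), hb₂])
      obtain ⟨s₂, h₂, hy₂, hl₂⟩ := ih (k + 1) s₁ (by omega) hy hlt
        (fun i => by rw [hl _ (hrs i), hs _ (hrs i).ne, hv]) he₀ he₁ he₂
      refine ⟨s₂, Exec.loop ?_ ((exec_assign _ _ _).seq h₁) h₂, hy₂, fun i hi => ?_⟩
      · rw [hb₁, hb₂]
        exact hlt k (by omega)
      · rw [hl₂ i hi, hl i hi, hs i hi.ne]
  -- The loop tests before its body, so `P` runs once beforehand for the candidate `0`.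
  refine ⟨seq (assign b (.lit 0)) (seq (assign (b + 2) (.lit 0)) (seq P
    (seq (loop (b + 1) (b + 2) (seq (assign b (.shift b 1)) P)) (assign o (.shift b 0))))),
    fun s v y hv hy => ?_⟩
  obtain ⟨hy, hlt⟩ := Nat.mem_rfind.mp hy
  have hs : ∀ i < b, Function.update (Function.update s b 0) (b + 2) 0 i = s i := by
    intro i hi
    rw [Function.update_of_ne (by omega), Function.update_of_ne (by omega)]
  obtain ⟨s₁, h₁, he₀, he₁, he₂, hl⟩ := hstep v 0
    (Function.update (Function.update s b 0) (b + 2) 0)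
    (fun i => by rw [hs _ (hrs i), hv]) (by simp) (by simp)
  obtain ⟨s₂, h₂, hy₂, hl₂⟩ := hloop v y y 0 s₁ (by omega) (by simpa using hy)
    (fun i hi => by simpa using hlt hi) (fun i => by rw [hl _ (hrs i), hs _ (hrs i), hv])
    he₀ he₁ he₂
  refine ⟨_, (exec_assign _ _ _).seq ((exec_assign _ _ _).seq
    (h₁.seq (h₂.seq (exec_assign _ _ _)))), ?_, ?_⟩
  · rw [← hy₂]
    simp [CounterTerm.val]
  · intro i hi hio
    rw [Function.update_of_ne hio, hl₂ i hi, hl i hi]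
    exact hs i hi

theorem computable_of_primrec' {n : ℕ} {f : List.Vector ℕ n → ℕ} (hf : Nat.Primrec' f) :
    Computable fun v => Part.some (f v) := by
  induction hf with
  | zero => exact computable_zero
  | succ => exact computable_succ
  | get i => exact computable_get i
  | comp g _ _ hf hg =>
    refine computable_comp hf hg fun v y hy => ⟨List.Vector.ofFn fun i => g i v, ?_, hy⟩
    intro i
    rw [List.Vector.get_ofFn]
    exact Part.mem_some _
  | prec _ _ hf hg => exact computable_prec hf hg

theorem mem_mOfFn {n : ℕ} {g : Fin n → Part ℕ} {ys : List.Vector ℕ n}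
    (h : ys ∈ List.Vector.mOfFn g) : ∀ i, ys.get i ∈ g i := by
  induction n with
  | zero => exact fun i => i.elim0
  | succ n ih =>
    simp only [List.Vector.mOfFn, Part.bind_eq_bind, Part.mem_bind_iff, Part.pure_eq_some,
      Part.mem_some_iff] at h
    obtain ⟨a, ha, l, hl, rfl⟩ := h
    exact Fin.cases (by simpa using ha) fun i => by simpa using ih hl i

/-- `Nat.Partrec'` applies unbounded search only to total functions, so the search of
`computable_rfind` never meets an undefined value. -/
theorem computable_of_partrec' {n : ℕ} {f : List.Vector ℕ n →. ℕ} (hf : Nat.Partrec' f) :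
    Computable f := by
  induction hf with
  | prim hf => exact computable_of_primrec' hf
  | comp g _ _ hf hg =>
    refine computable_comp hf hg fun v y hy => ?_
    obtain ⟨ys, hys, hy⟩ := Part.mem_bind_iff.mp hy
    exact ⟨ys, mem_mOfFn hys, hy⟩
  | rfind _ hf => exact computable_rfind hf

end RegProg

end DDSAs

namespace DDSAs

open Relation

namespace RegProg

/-! ### Control points -/

/-- The control points that are visited while `P` is executed with continuation `K`. -/
def points : RegProg → List RegProg → List (List RegProg)
  | assign o t, K => [assign o t :: K]
  | seq P Q, K => (seq P Q :: K) :: (P.points (Q :: K) ++ Q.points K)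
  | loop x y P, K => (loop x y P :: K) :: P.points (loop x y P :: K)

theorem cons_mem_points (P : RegProg) (K : List RegProg) : P :: K ∈ P.points K := by
  cases P <;> simp [points]

/-- The points of `P` can be left only towards the continuation `K`. For a subprogram, that
continuation is again a point of the enclosing program or its own continuation. -/
theorem Step.mem_points {c c' : Cfg} (h : Step c c') (P : RegProg) :
    ∀ K, c.1 ∈ P.points K → c'.1 ∈ P.points K ∨ c'.1 = K := by
  induction P with
  | assign o t =>
    intro K hc
    obtain ⟨L, s⟩ := c
    obtain rfl := List.mem_singleton.mp hc
    cases h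
    exact Or.inr rfl
  | seq P Q ihP ihQ =>
    intro K hc
    simp only [points, List.mem_cons, List.mem_append] at hc ⊢
    rcases hc with hc | hc | hc
    · obtain ⟨L, s⟩ := c
      obtain rfl : L = _ := hc
      cases h
      exact Or.inl (Or.inr (Or.inl (cons_mem_points _ _)))
    · rcases ihP _ hc with h | h
      · exact Or.inl (Or.inr (Or.inl h))
      · exact Or.inl (Or.inr (Or.inr (h ▸ cons_mem_points _ _)))
    · rcases ihQ _ hc with h | h
      · exact Or.inl (Or.inr (Or.inr h))
      · exact Or.inr h
  | loop x y P ih =>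
    intro K hc
    simp only [points, List.mem_cons] at hc ⊢
    rcases hc with hc | hc
    · obtain ⟨L, s⟩ := c
      obtain rfl : L = _ := hc
      cases h
      · exact Or.inr rfl
      · exact Or.inl (Or.inr (cons_mem_points _ _))
    · rcases ih _ hc with h | h
      · exact Or.inl (Or.inr h)
      · exact Or.inl (Or.inl h)

/-- All control points of an execution of `P`. -/
def labels (P : RegProg) : List (List RegProg) := [] :: P.points []

theorem mem_labels_of_reach {P : RegProg} {s : ℕ → ℕ} {c : Cfg}
    (h : ReflTransGen Step ([P], s) c) : c.1 ∈ P.labels := by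
  induction h with
  | refl => exact List.mem_cons_of_mem _ (cons_mem_points P [])
  | tail _ hs ih =>
    rcases List.mem_cons.mp ih with h | h
    · cases hs <;> simp at h
    · rcases hs.mem_points P [] h with h | h
      · exact List.mem_cons_of_mem _ h
      · exact h ▸ List.mem_cons_self

/-- A terminating execution visits finitely many configurations. -/
theorem finite_reach {c c' : Cfg} (h : ReflTransGen Step c c') (hc' : ∀ d, ¬ Step c' d) :
    {d | ReflTransGen Step c d}.Finite := by
  induction h using ReflTransGen.head_induction_on with
  | refl =>
    refine (Set.finite_singleton c').subset fun d hd => ?_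
    rcases ReflTransGen.cases_head hd with h | ⟨e, he, -⟩
    · exact h.symm
    · exact absurd he (hc' e)
  | @head c d hs _ ih =>
    refine (ih.insert c).subset fun d hd => ?_
    rcases ReflTransGen.cases_head hd with h | ⟨e, he, hed⟩
    · exact Or.inl h.symm
    -- By determinism every path from `c` passes through the same successor.
    · exact Or.inr (hs.unique he ▸ hed)

/-! ### Translation to counter systems -/

/-- The registers of a program are below `R`. -/
def Below (R : ℕ) : RegProg → Prop
  | assign o (.lit _) => o < R
  | assign o (.shift x _) => o < R ∧ x < R
  | seq P Q => P.Below R ∧ Q.Below R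
  | loop x y P => x < R ∧ y < R ∧ P.Below R

theorem Below.mono {R R' : ℕ} (h : R ≤ R') {P : RegProg} (hP : P.Below R) : P.Below R' := by
  induction P with
  | assign o t => cases t <;> simp only [Below] at hP ⊢ <;> omega
  | seq P Q ihP ihQ => exact ⟨ihP hP.1, ihQ hP.2⟩
  | loop x y P ih => exact ⟨hP.1.trans_le h, hP.2.1.trans_le h, ih hP.2.2⟩

theorem exists_below (P : RegProg) : ∃ R, P.Below R := by
  induction P with
  | assign o t =>
    cases t with
    | lit c => exact ⟨o + 1, Nat.lt_succ_self o⟩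
    | shift x c => exact ⟨o + x + 1, by simp only [Below]; omega⟩
  | seq P Q ihP ihQ =>
    obtain ⟨R, h⟩ := ihP
    obtain ⟨R', h'⟩ := ihQ
    exact ⟨R + R', h.mono (by omega), h'.mono (by omega)⟩
  | loop x y P ih =>
    obtain ⟨R, h⟩ := ih
    exact ⟨R + x + y + 1, by omega, by omega, h.mono (by omega)⟩

theorem below_of_mem_points {R : ℕ} (P : RegProg) : ∀ K : List RegProg, P.Below R →
    (∀ Q ∈ K, Below R Q) → ∀ L ∈ P.points K, ∀ Q ∈ L, Below R Q := by
  induction P with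
  | assign o t =>
    intro K hP hK L hL
    obtain rfl := List.mem_singleton.mp hL
    exact List.forall_mem_cons.mpr ⟨hP, hK⟩
  | seq P Q ihP ihQ =>
    intro K hP hK L hL
    simp only [points, List.mem_cons, List.mem_append] at hL
    rcases hL with rfl | hL | hL
    · exact List.forall_mem_cons.mpr ⟨hP, hK⟩
    · exact ihP _ hP.1 (List.forall_mem_cons.mpr ⟨hP.2, hK⟩) L hL
    · exact ihQ _ hP.2 hK L hL
  | loop x y P ih =>
    intro K hP hK L hL
    simp only [points, List.mem_cons] at hL
    rcases hL with rfl | hL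
    · exact List.forall_mem_cons.mpr ⟨hP, hK⟩
    · exact ih _ hP.2.2 (List.forall_mem_cons.mpr ⟨hP, hK⟩) L hL

theorem below_of_mem_labels {R : ℕ} {P : RegProg} (hP : P.Below R) :
    ∀ L ∈ P.labels, ∀ Q ∈ L, Below R Q := by
  intro L hL
  rcases List.mem_cons.mp hL with rfl | hL
  · simp
  · exact below_of_mem_points P [] hP (by simp) L hL

end RegProg

end DDSAs

namespace DDSAs

open Relation

def CounterTerm.map {X Y : Type} (f : X → Y) : CounterTerm X → CounterTerm Y
  | lit c => lit c
  | shift x c => shift (f x) c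

namespace RegProg

section Translation

variable (R : ℕ) (idx : List RegProg → ℕ)

/-- The counters are the registers below `R`, the program counter `R`, and an additional
counter `R + 1`. -/
def encode (c : Cfg) (m : ℕ) : Fin (R + 2) → ℕ :=
  fun i => if i.val < R then c.2 i else if i.val = R then idx c.1 else m

/-- The index is reduced modulo `R + 2`, so it is meaningful only for `x < R + 2`. -/
def reg (x : ℕ) : Fin (R + 2) := Fin.ofNat (R + 2) x

theorem val_reg {x : ℕ} (h : x < R + 2) : (reg R x).val = x := Nat.mod_eq_of_lt h

theorem encode_reg (c : Cfg) (m : ℕ) {x : ℕ} (h : x < R) : encode R idx c m (reg R x) = c.2 x := by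
  simp [encode, val_reg R (x := x) (by omega), h]

theorem encode_pc (c : Cfg) (m : ℕ) : encode R idx c m (reg R R) = idx c.1 := by
  simp [encode, val_reg R (x := R) (by omega)]

theorem encode_extra (c : Cfg) (m : ℕ) : encode R idx c m (reg R (R + 1)) = m := by
  simp [encode, val_reg R (x := R + 1) (by omega)]

theorem funext_reg {x y : Fin (R + 2) → ℕ} (h : ∀ i < R, x (reg R i) = y (reg R i))
    (hp : x (reg R R) = y (reg R R)) (he : x (reg R (R + 1)) = y (reg R (R + 1))) : x = y := by
  funext i
  have hi : i = reg R i.val := Fin.ext (val_reg R i.2).symm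
  rw [hi]
  rcases Nat.lt_trichotomy i.val R with h' | h' | h'
  · exact h _ h'
  · rw [h', hp]
  · rw [show i.val = R + 1 by omega, he]

theorem reg_ne {x y : ℕ} (hx : x < R + 2) (hy : y < R + 2) (h : x ≠ y) : reg R x ≠ reg R y := by
  intro h'
  have := congrArg Fin.val h'
  rw [val_reg R hx, val_reg R hy] at this
  exact h this

/-- The test that the control point is `L`. -/
def atPoint (L : List RegProg) : CounterTest (Fin (R + 2)) :=
  .eq (.shift (reg R R) 0) (.lit (idx L))

/-- The assignment that changes the control point to `L`. -/
def goto (L : List RegProg) : Fin (R + 2) → CounterTerm (Fin (R + 2)) :=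
  Function.update (fun i => .shift i 0) (reg R R) (.lit (idx L))

/-- One action for each `Step` rule applicable to the stack; the empty stack means halting and has
none. -/
def actionsAt : List RegProg → List (CounterAction (Fin (R + 2)))
  | [] => []
  | assign o t :: K =>
    [⟨[atPoint R idx (assign o t :: K)], Function.update (goto R idx K) (reg R o) (t.map (reg R))⟩]
  | seq P Q :: K => [⟨[atPoint R idx (seq P Q :: K)], goto R idx (P :: Q :: K)⟩]
  | loop x y P :: K =>
    [⟨[atPoint R idx (loop x y P :: K), .eq (.shift (reg R x) 0) (.shift (reg R y) 0)],
        goto R idx K⟩,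
      ⟨[atPoint R idx (loop x y P :: K), .ne (.shift (reg R x) 0) (.shift (reg R y) 0)],
        goto R idx (P :: loop x y P :: K)⟩]

variable {R idx}

theorem holds_atPoint (L : List RegProg) (c : Cfg) (m : ℕ) :
    (atPoint R idx L).Holds (encode R idx c m) ↔ idx c.1 = idx L := by
  simp [atPoint, CounterTest.Holds, CounterTerm.val, encode_pc]

theorem atPoint_mem {L : List RegProg} {a : CounterAction (Fin (R + 2))}
    (ha : a ∈ actionsAt R idx L) : atPoint R idx L ∈ a.tests := by
  match L with
  | [] => simp [actionsAt] at ha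
  | assign o t :: K =>
    obtain rfl := List.mem_singleton.mp ha
    simp
  | seq P Q :: K =>
    obtain rfl := List.mem_singleton.mp ha
    simp
  | loop x y P :: K =>
    rcases List.mem_pair.mp ha with rfl | rfl <;> simp

theorem goto_val (L K : List RegProg) (s : ℕ → ℕ) (m : ℕ) :
    (fun v => (goto R idx K v).val (encode R idx (L, s) m)) = encode R idx (K, s) m := by
  refine funext_reg R (fun i hi => ?_) ?_ ?_
  · simp [goto, Function.update_of_ne (reg_ne R (by omega) (by omega) hi.ne), CounterTerm.val,
      encode_reg R idx _ _ hi]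
  · simp [goto, CounterTerm.val, encode_pc]
  · simp [goto, Function.update_of_ne (reg_ne R (x := R + 1) (y := R) (by omega) (by omega)
      (by omega)), CounterTerm.val, encode_extra]

/-- Since `o < R`, the outer update cannot overwrite the program counter. -/
theorem goto_update_val {o : ℕ} {t : CounterTerm ℕ} (hb : Below R (assign o t))
    (L K : List RegProg) (s : ℕ → ℕ) (m : ℕ) :
    (fun v => (Function.update (goto R idx K) (reg R o) (t.map (reg R)) v).val
      (encode R idx (L, s) m)) = encode R idx (K, Function.update s o (t.val s)) m := by
  have ho : o < R := by
    cases t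
    · exact hb
    · exact hb.1
  have hg := fun v => congrFun (goto_val (R := R) (idx := idx) L K s m) v
  have hne : ∀ i < R + 2, i ≠ o → (Function.update (goto R idx K) (reg R o) (t.map (reg R))
      (reg R i)).val (encode R idx (L, s) m) = encode R idx (K, s) m (reg R i) := by
    intro i hi hio
    rw [Function.update_of_ne (reg_ne R hi (by omega) hio)]
    exact hg _
  refine funext_reg R (fun i hi => ?_) ?_ ?_
  · rcases eq_or_ne i o with rfl | hio
    · rw [encode_reg R idx _ _ hi]
      cases t with
      | lit c => simp [CounterTerm.map, CounterTerm.val]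
      | shift x c => simp [CounterTerm.map, CounterTerm.val, encode_reg R idx _ _ hb.2]
    · rw [hne i (by omega) hio, encode_reg R idx _ _ hi, encode_reg R idx _ _ hi]
      exact (Function.update_of_ne hio _ _).symm
  · rw [hne R (by omega) (by omega), encode_pc, encode_pc]
  · rw [hne (R + 1) (by omega) (by omega), encode_extra, encode_extra]

theorem step_of_enabled {L : List RegProg} {s : ℕ → ℕ} {m : ℕ} (hb : ∀ P ∈ L, Below R P)
    {a : CounterAction (Fin (R + 2))} (ha : a ∈ actionsAt R idx L)
    (hen : a.Enabled (encode R idx (L, s) m)) :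
    ∃ c, Step (L, s) c ∧ a.next (encode R idx (L, s) m) = encode R idx c m := by
  match L with
  | [] => simp [actionsAt] at ha
  | assign o t :: K =>
    obtain rfl := List.mem_singleton.mp ha
    exact ⟨_, Step.assign o t K s, goto_update_val (hb _ List.mem_cons_self) _ _ _ _⟩
  | seq P Q :: K =>
    obtain rfl := List.mem_singleton.mp ha
    exact ⟨_, Step.seq P Q K s, goto_val _ _ _ _⟩
  | loop x y P :: K =>
    obtain ⟨hx, hy, -⟩ := hb _ List.mem_cons_self
    rcases List.mem_pair.mp ha with rfl | rfl
    · have h := hen _ (List.mem_cons_of_mem _ List.mem_cons_self)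
      simp only [CounterTest.Holds, CounterTerm.val, encode_reg R idx _ _ hx,
        encode_reg R idx _ _ hy] at h
      exact ⟨_, Step.exit x y P K s h, goto_val _ _ _ _⟩
    · have h := hen _ (List.mem_cons_of_mem _ List.mem_cons_self)
      simp only [CounterTest.Holds, CounterTerm.val, encode_reg R idx _ _ hx,
        encode_reg R idx _ _ hy] at h
      exact ⟨_, Step.enter x y P K s h, goto_val _ _ _ _⟩

theorem exists_enabled {c c' : Cfg} (h : Step c c') (hb : ∀ P ∈ c.1, Below R P) (m : ℕ) :
    ∃ a ∈ actionsAt R idx c.1, a.Enabled (encode R idx c m) ∧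
      encode R idx c' m = a.next (encode R idx c m) := by
  cases h with
  | assign o t K s =>
    refine ⟨_, List.mem_singleton_self _, ?_,
      (goto_update_val (hb _ List.mem_cons_self) _ _ _ _).symm⟩
    exact List.forall_mem_singleton.mpr ((holds_atPoint _ _ _).mpr rfl)
  | seq P Q K s =>
    refine ⟨_, List.mem_singleton_self _, ?_, (goto_val _ _ _ _).symm⟩
    exact List.forall_mem_singleton.mpr ((holds_atPoint _ _ _).mpr rfl)
  | exit x y P K s h =>
    obtain ⟨hx, hy, -⟩ := hb _ List.mem_cons_self
    refine ⟨_, List.mem_cons_self, ?_, (goto_val _ _ _ _).symm⟩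
    refine List.forall_mem_cons.mpr ⟨(holds_atPoint _ _ _).mpr rfl,
      List.forall_mem_singleton.mpr ?_⟩
    simpa only [CounterTest.Holds, CounterTerm.val, encode_reg R idx _ _ hx,
      encode_reg R idx _ _ hy, Nat.add_zero] using h
  | enter x y P K s h =>
    obtain ⟨hx, hy, -⟩ := hb _ List.mem_cons_self
    refine ⟨_, List.mem_cons_of_mem _ List.mem_cons_self, ?_, (goto_val _ _ _ _).symm⟩
    refine List.forall_mem_cons.mpr ⟨(holds_atPoint _ _ _).mpr rfl,
      List.forall_mem_singleton.mpr ?_⟩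
    simpa only [CounterTest.Holds, CounterTerm.val, encode_reg R idx _ _ hx,
      encode_reg R idx _ _ hy, Nat.add_zero] using h

variable (R idx)

/-- The action that counts up the additional counter, as long as it is below register `z`. -/
def drain (z : ℕ) : CounterAction (Fin (R + 2)) where
  tests := [.lt (.shift (reg R (R + 1)) 0) (.shift (reg R z) 0)]
  assign := Function.update (fun i => .shift i 0) (reg R (R + 1)) (.shift (reg R (R + 1)) 1)

/-- The counter system that executes `P` and may at any time count up to register `z`. -/
def system (z : ℕ) (P : RegProg) : List (CounterAction (Fin (R + 2))) :=
  drain R z :: P.labels.flatMap (actionsAt R idx)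

variable {R idx}

theorem drain_enabled {z : ℕ} (x : Fin (R + 2) → ℕ) :
    (drain R z).Enabled x ↔ x (reg R (R + 1)) < x (reg R z) := by
  simp [drain, CounterAction.Enabled, CounterTest.Holds, CounterTerm.val]

theorem drain_next_extra {z : ℕ} (x : Fin (R + 2) → ℕ) :
    (drain R z).next x (reg R (R + 1)) = x (reg R (R + 1)) + 1 := by
  simp [drain, CounterAction.next, CounterTerm.val]

theorem drain_next_of_le {z : ℕ} (x : Fin (R + 2) → ℕ) {i : ℕ} (hi : i ≤ R) :
    (drain R z).next x (reg R i) = x (reg R i) := by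
  simp [drain, CounterAction.next, CounterTerm.val,
    Function.update_of_ne (reg_ne R (x := i) (y := R + 1) (by omega) (by omega) (by omega))]

theorem drain_next_encode {z : ℕ} (c : Cfg) (m : ℕ) :
    (drain R z).next (encode R idx c m) = encode R idx c (m + 1) := by
  refine funext_reg R (fun i hi => ?_) ?_ ?_
  · rw [drain_next_of_le _ hi.le, encode_reg R idx _ _ hi, encode_reg R idx _ _ hi]
  · rw [drain_next_of_le _ le_rfl, encode_pc, encode_pc]
  · rw [drain_next_extra, encode_extra, encode_extra]

/-- The drain action is never used here, so the extra counter stays `0`, as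
`not_hasFiniteSummary_counterDDSA` requires. -/
theorem reach_encode {z : ℕ} {P : RegProg} (hP : P.Below R) {s : ℕ → ℕ} {c : Cfg}
    (h : ReflTransGen Step ([P], s) c) :
    ReflTransGen (CounterStep (system R idx z P)) (encode R idx ([P], s) 0) (encode R idx c 0) := by
  induction h with
  | refl => exact ReflTransGen.refl
  | @tail c d hc hs ih =>
    have hl := mem_labels_of_reach hc
    obtain ⟨a, ha, hen, he⟩ := exists_enabled (idx := idx) hs (below_of_mem_labels hP _ hl) 0
    exact ih.tail ⟨a, List.mem_cons_of_mem _ (List.mem_flatMap.mpr ⟨_, hl, ha⟩), hen, he⟩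

/-- A halting run has a maximal value `M` of register `z`, and draining only happens below `z`, so
the extra counter never exceeds `M`, even if `z` drops later. Injectivity of `idx` on labels ensures
that only actions of the current control point fire. -/
theorem finite_reach_system {z : ℕ} (hz : z < R) {P : RegProg} (hP : P.Below R)
    (hidx : ∀ L ∈ P.labels, ∀ L' ∈ P.labels, idx L = idx L' → L = L') {s s' : ℕ → ℕ}
    (h : ReflTransGen Step ([P], s) ([], s')) :
    {x | ReflTransGen (CounterStep (system R idx z P)) (encode R idx ([P], s) 0) x}.Finite := by
  have hfin : {c | ReflTransGen Step ([P], s) c}.Finite := finite_reach h (fun d hd => by cases hd)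
  obtain ⟨M, hM⟩ := (hfin.image fun c => c.2 z).bddAbove
  refine ((hfin.prod (Set.finite_Iic M)).image fun p => encode R idx p.1 p.2).subset ?_
  intro x hx
  induction (show ReflTransGen _ _ x from hx) with
  | refl => exact ⟨(([P], s), 0), ⟨ReflTransGen.refl, Nat.zero_le M⟩, rfl⟩
  | tail _ hs ih =>
    obtain ⟨⟨⟨L, t⟩, m⟩, ⟨hc, hm⟩, rfl⟩ := ih ‹_›
    obtain ⟨a, ha, hen, rfl⟩ := hs
    rcases List.mem_cons.mp ha with rfl | ha
    · refine ⟨((L, t), m + 1), ⟨hc, ?_⟩, (drain_next_encode _ _).symm⟩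
      have hlt : encode R idx (L, t) m (reg R (R + 1)) < encode R idx (L, t) m (reg R z) :=
        (drain_enabled _).mp hen
      rw [encode_extra, encode_reg R idx _ _ hz] at hlt
      exact Nat.succ_le_of_lt (hlt.trans_le (hM ⟨_, hc, rfl⟩))
    · obtain ⟨L', hL', ha⟩ := List.mem_flatMap.mp ha
      have hl := mem_labels_of_reach hc
      obtain rfl : L = L' := hidx _ hl _ hL'
        ((holds_atPoint _ _ _).mp (hen _ (atPoint_mem ha)))
      obtain ⟨d, hd, he⟩ := step_of_enabled (below_of_mem_labels hP _ hl) ha hen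
      exact ⟨(d, m), ⟨ReflTransGen.tail hc hd, hm⟩, he.symm⟩

end Translation

end RegProg

end DDSAs

namespace DDSAs

open Relation

/-! ### Turning the output value into halting or unbounded counting. -/

namespace RegProg

/-- Run `P`, and then count up register `2` forever unless register `1` is zero. -/
def thenDiverge (P : RegProg) : RegProg :=
  seq P (seq (assign 2 (.lit 0)) (seq (assign 3 (.lit 0)) (loop 1 3 (assign 2 (.shift 2 1)))))

/-- Registers `2` and `3` may hold leftovers of `P`, so both are cleared; register `3` is the zero
with which register `1` is compared. -/
theorem reach_loop {P : RegProg} {s s' : ℕ → ℕ} (h : Exec P s s') :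
    ReflTransGen Step ([thenDiverge P], s) ([loop 1 3 (assign 2 (.shift 2 1))],
      Function.update (Function.update s' 2 0) 3 0) :=
  ReflTransGen.head (Step.seq _ _ _ _) ((h _).trans (ReflTransGen.head (Step.seq _ _ _ _)
    (ReflTransGen.head (Step.assign _ _ _ _) (ReflTransGen.head (Step.seq _ _ _ _)
      (ReflTransGen.single (Step.assign _ _ _ _))))))

theorem thenDiverge_halts {P : RegProg} {s s' : ℕ → ℕ} (h : Exec P s s') (h0 : s' 1 = 0) :
    ∃ t, ReflTransGen Step ([thenDiverge P], s) ([], t) :=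
  ⟨_, (reach_loop h).tail (Step.exit _ _ _ _ _ (by simp [h0]))⟩

theorem thenDiverge_diverges {P : RegProg} {s s' : ℕ → ℕ} (h : Exec P s s') (h1 : s' 1 ≠ 0)
    (k : ℕ) : ∃ c : Cfg, ReflTransGen Step ([thenDiverge P], s) c ∧ c.2 2 = k := by
  suffices H : ∃ t : ℕ → ℕ, ReflTransGen Step ([thenDiverge P], s)
      ([loop 1 3 (assign 2 (.shift 2 1))], t) ∧ t 1 ≠ t 3 ∧ t 2 = k by
    obtain ⟨t, ht, -, hk⟩ := H
    exact ⟨_, ht, hk⟩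
  induction k with
  | zero => exact ⟨_, reach_loop h, by simpa using h1, by simp⟩
  | succ k ih =>
    obtain ⟨t, ht, hne, hk⟩ := ih
    refine ⟨_, (ht.tail (Step.enter _ _ _ _ _ hne)).tail (Step.assign _ _ _ _), ?_, ?_⟩
    · simpa using hne
    · simp [CounterTerm.val, hk]

end RegProg

/-! ### Recursive inseparability -/

/-- The inputs on which a suitable partial recursive function is `0`, respectively `1`, cannot be
separated by a computable function. -/
theorem exists_inseparable : ∃ f : ℕ →. ℕ, Partrec f ∧ ∀ g : ℕ → Bool, Computable g →
    ¬ ∀ n, (0 ∈ f n → g n = true) ∧ (1 ∈ f n → ¬ g n = true) := by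
  refine ⟨fun n => (Denumerable.ofNat Nat.Partrec.Code n).eval n,
    Nat.Partrec.Code.eval_part.comp (Computable.ofNat _) Computable.id, fun g hg h => ?_⟩
  -- Diagonalization: this function contradicts `g` at every input, in particular at its own code.
  have hp : Computable fun n => bif g n then 1 else 0 :=
    Computable.cond hg (Computable.const 1) (Computable.const 0)
  obtain ⟨c, hc⟩ := Nat.Partrec.Code.exists_code.mp (Partrec.nat_iff.mp hp.partrec)
  have h := h (Encodable.encode c)
  beta_reduce at h
  rw [Denumerable.ofNat_encode, hc] at h
  cases hb : g (Encodable.encode c) <;> simp [hb] at h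

/-! ### The computable reduction and the conclusion. -/

section Undecidable

variable {K D : Type} [CommRing K] [Coded K] [CommRing D] [LinearOrder D] [IsStrictOrderedRing D]
  [Algebra K D]

/-- The number `n` affects only the head of the list of initial values, and the code of a list is
`Nat.succ` of the pair of the codes of its head and tail; all other components are constants. -/
theorem computable_code_counterDDSA (hK : Primrec fun n : ℕ => Coded.code (n : K)) {V : ℕ}
    (acts : List (CounterAction (Fin (V + 1)))) (x : Fin V → ℕ) :
    Computable fun n : ℕ =>
      Coded.code (⟨counterDDSA K acts (Fin.cons n x), []⟩ : Input K) := by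
  have hval : ∀ n : ℕ, Coded.code (fun i => ((Fin.cons n x : Fin (V + 1) → ℕ) i : K)) =
      Nat.succ (Nat.pair (Coded.code (n : K)) (Coded.code (fun i => (x i : K)))) := by
    intro n
    change Encodable.encode ((List.ofFn _).map Coded.code) = _
    rw [List.ofFn_succ]
    rfl
  have hcode : ∀ n : ℕ, Coded.code (⟨counterDDSA K acts (Fin.cons n x), []⟩ : Input K) =
      let S := counterDDSA K acts (Fin.cons 0 x)
      Nat.pair (Nat.pair 1 (Nat.pair acts.length (Nat.pair (V + 1) (Nat.pair (Coded.code S.init)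
        (Nat.pair (Coded.code S.trans) (Nat.pair (Coded.code S.final) (Nat.pair
          (Nat.succ (Nat.pair (Coded.code (n : K)) (Coded.code (fun i => (x i : K)))))
          (Coded.code S.guard))))))))
        (Coded.code ([] : List (Constraint K (Fin S.numVars)))) := by
    intro n
    rw [← hval]
    rfl
  simp only [hcode]
  have hp : ∀ {f g : ℕ → ℕ}, Primrec f → Primrec g → Primrec fun n => Nat.pair (f n) (g n) :=
    fun hf hg => Primrec₂.natPair.comp hf hg
  have hc := fun c : ℕ => Primrec.const (α := ℕ) c
  exact (hp (hp (hc _) (hp (hc _) (hp (hc _) (hp (hc _) (hp (hc _) (hp (hc _)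
    (hp (Primrec.succ.comp (hp hK (hc _))) (hc _)))))))) (hc _)).to_comp

theorem not_algDecidable_hasFiniteSummary (hK : Primrec fun n : ℕ => Coded.code (n : K)) :
    ¬ AlgDecidable (fun I : Input K => I.sys.HasFiniteSummary D I.constraints) := by
  classical
  rintro ⟨g, hg, hdec⟩
  obtain ⟨f, hf, hsep⟩ := exists_inseparable
  -- Input in register `0`, output in register `1`, scratch from register `2` on.
  obtain ⟨P, hP⟩ := RegProg.computable_of_partrec' (Nat.Partrec'.part_iff₁.mpr hf)
    (fun _ => 0) 1 2 (by simp) (by omega)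
  obtain ⟨R', hR'⟩ := P.thenDiverge.exists_below
  -- The summand makes registers `0` and `2` genuine counters below `R`, whatever `P` uses.
  set R := R' + 4 with hRdef
  have hR : RegProg.Below R P.thenDiverge := hR'.mono (by omega)
  have hidx : ∀ L ∈ P.thenDiverge.labels, ∀ L' ∈ P.thenDiverge.labels,
      P.thenDiverge.labels.idxOf L = P.thenDiverge.labels.idxOf L' → L = L' :=
    fun L hL L' _ h => (List.idxOf_inj hL).mp h
  set idx := fun L => P.thenDiverge.labels.idxOf L with hidxdef
  let acts := RegProg.system R idx 2 P.thenDiverge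
  let s : ℕ → ℕ → ℕ := fun n i => if i = 0 then n else 0
  have hinit : ∀ n, RegProg.encode R idx ([P.thenDiverge], s n) 0 =
      Fin.cons n fun i => RegProg.encode R idx ([P.thenDiverge], s 0) 0 i.succ := by
    intro n
    funext i
    refine Fin.cases ?_ (fun i => ?_) i
    · simp [RegProg.encode, s, hRdef]
    · simp [RegProg.encode, s]
  -- The supposed decision procedure, applied to the code of the system for `n`, is the forbidden
  -- separator.
  refine hsep _ (hg.comp (computable_code_counterDDSA hK acts
    fun i => RegProg.encode R idx ([P.thenDiverge], s 0) 0 i.succ)) fun n => ?_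
  rw [hdec, ← hinit]
  have hexec : ∀ y ∈ f n, ∃ s', RegProg.Exec P (s n) s' ∧ s' 1 = y := by
    intro y hy
    obtain ⟨s', h, h1, -⟩ := hP (s n) (n ::ᵥ List.Vector.nil) y (fun i => by simp [s]) hy
    exact ⟨s', h, h1⟩
  constructor
  · intro h0
    obtain ⟨s', h, h1⟩ := hexec 0 h0
    obtain ⟨t, ht⟩ := RegProg.thenDiverge_halts h h1
    exact hasFiniteSummary_counterDDSA
      (RegProg.finite_reach_system (by omega) hR hidx ht)
  · intro h0
    obtain ⟨s', h, h1⟩ := hexec 1 h0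
    refine not_hasFiniteSummary_counterDDSA (d := RegProg.drain R 2) (z := RegProg.reg R 2)
      (m := RegProg.reg R (R + 1)) List.mem_cons_self RegProg.drain_enabled
      (fun x => RegProg.drain_next_of_le x (by omega)) RegProg.drain_next_extra fun k => ?_
    obtain ⟨c, hc, hk⟩ := RegProg.thenDiverge_diverges h (by omega) k
    refine ⟨_, RegProg.reach_encode hR hc, ?_, RegProg.encode_extra _ _ _ _⟩
    rw [RegProg.encode_reg R idx _ _ (by omega), hk]

theorem primrec_code_natCast_int : Primrec fun n : ℕ => Coded.code (n : ℤ) :=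
  (Primrec.nat_mul.comp (Primrec.const 2) Primrec.id).of_eq fun n => by simp [Coded.code]

theorem primrec_code_natCast_rat : Primrec fun n : ℕ => Coded.code (n : ℚ) :=
  (Primrec₂.natPair.comp primrec_code_natCast_int (Primrec.const 1)).of_eq fun n => by
    simp [Coded.code]

end Undecidable

end DDSAs

theorem mainTheorem7 :
    (¬ AlgDecidable (fun I : DDSAs.Input ℤ => I.sys.HasFiniteSummary ℤ I.constraints)) ∧
    (¬ AlgDecidable (fun I : DDSAs.Input ℚ => I.sys.HasFiniteSummary ℚ I.constraints)) ∧
    (¬ AlgDecidable (fun I : DDSAs.Input ℚ => I.sys.HasFiniteSummary ℝ I.constraints)) :=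
  ⟨DDSAs.not_algDecidable_hasFiniteSummary DDSAs.primrec_code_natCast_int,
    DDSAs.not_algDecidable_hasFiniteSummary DDSAs.primrec_code_natCast_rat,
    DDSAs.not_algDecidable_hasFiniteSummary DDSAs.primrec_code_natCast_rat⟩
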